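/- Let $n\ge 1$ and $k\ge 2$ be integers with $k\mid n$, put $C=\binom{n-1}{k-1}$, and let $\sigma\in(0,1)$. Let $A_0,A_1,\dots,A_m$ be real symmetric $n\times n$ matrices, $b\in\mathbb R^m$, and consider the semidefinite program $\inf\{\langle A_0,X\rangle:\ \langle A_i,X\rangle=b_i\ (i=1,\dots,m),\ X\succeq 0\}$, where $\langle X,Y\rangle=\operatorname{tr}(XY)$. **Notation.** Let $f^{\mathrm{SDP}}(X)=-\log\det X$. The central path consists of the minimizers of $\eta\langle A_0,X\rangle+f^{\mathrm{SDP}}(X)$ over $\{X\succ0:\langle A_i,X\rangle=b_i\ \forall i\ge 1\}$, $\eta>0$. For $v\in\mathbb R$ let $L(v)$ be the set of symmetric $X$ with $\langle A_0,X\rangle=v$ and $\langle A_i,X\rangle=b_i$ for $i\ge1$. For collections $\mathcal Y=(Y_J)$ of symmetric $k\times k$ matrices indexed by the $k$-subsets $J$ of $\{1,\dots,n\}$ let $\Psi(\mathcal Y)=\sum_J Y_J^{\to n}$, where $Y_J^{\to n}$ is the $n\times n$ matrix with principal submatrix $Y_J$ on $J$ and zeros elsewhere; let $f^{\mathrm{FW}(k)}(\mathcal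 Y)=-\sum_J\log\det Y_J$ and let $\mathcal Y_0$ have all blocks equal to $C^{-1}I$, so that $\Psi(\mathcal Y_0)=I$. For symmetric $X$ let $\Psi^\dagger(X)_J$ be $X_{J,J}$ with diagonal entries divided by $C$ and off-diagonal entries divided by $\binom{n-2}{k-2}$. Given $X\succ0$, the rescaled data are $X^{1/2}A_iX^{1/2}$ ($0\le i\le m$); $L_X(v)$ is the space $L(v)$ formed with the rescaled data, and $L^\Psi_X(v)=\{\mathcal Y:\Psi(\mathcal Y)\in L_X(v)\}$. For a function $f$ with gradient $g$ and positive definite Hessian $H$, the Newton step at $x$ of the restriction $f_{|L}$ to an affine space $L$ is the projection of $-H(x)^{-1}g(x)$ onto the direction space of $L$, orthogonal with respect to $\langle u,w\rangle_x=\langle u,H(x)w\rangle$, and the Newton decrement $\Delta(f_{|L},x)$ is its norm $\|\cdot\|_x$. **Predictor step.** From $X_1\succ0$: with $A_i'=X_1^{1/2}A_iX_1^{1/2}$, let $y$ solve $\sum_{j}\langle A_i',A_j'\rangle y_j=\langle A_i',A_0'\rangle$ ($1\le i\le m$), let $\mathcal Z=\Psi^\dagger\bigl(\sum_j y_jA_j'-A_0'\bigr)$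 and $s^*=\sup\{s:\mathcal Y_0+s\mathcal Z\text{ has positive semidefinite blocks}\}$; the result is $X_2=X_1^{1/2}\,\Psi(\mathcal Y_0+\sigma s^*\mathcal Z)\,X_1^{1/2}$ (and $X_2=X_1$ if $\mathcal Z=0$). **Corrector phase.** With $v_2=\langle A_0,X_2\rangle$, start from the state $(X,\mathcal Y)=(X_2,\mathcal Y_0)$. While $\Delta(f^{\mathrm{FW}(k)}_{|L^\Psi_X(v_2)},\mathcal Y)>\frac1{14}$ one may perform a line search, which replaces $\mathcal Y$ by an exact minimizer of $f^{\mathrm{FW}(k)}$, over collections with positive definite blocks, on the line through $\mathcal Y$ along the Newton step of $f^{\mathrm{FW}(k)}_{|L^\Psi_X(v_2)}$. At any time one may rescale, replacing $(X,\mathcal Y)$ by $(X^{1/2}\Psi(\mathcal Y)X^{1/2},\mathcal Y_0)$. The next predictor step may be taken from $X$ when $\Delta(f^{\mathrm{FW}(k)}_{|L^\Psi_X(v_2)},\mathcal Y_0)\le\frac1{14}$. **Lemma.** Let $X_1\succ0$ satisfy $\langle A_i,X_1\rangle=b_i$ for $i\ge1$, put $v_1=\langle A_0,X_1\rangle$,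 and suppose that the central path contains a point $z(v_1)$ with objective value $v_1$ and that $\Delta(f^{\mathrm{SDP}}_{|L(v_1)},X_1)\le\frac19$. Let $X_2$ be the result of the predictor step from $X_1$, let $v_2=\langle A_0,X_2\rangle$, and let $$K=\left\lceil 2688\,C\left(n\log\frac1{1-\sigma}+\frac1{154}\right)\right\rceil .$$ Then: 1. The central path contains a point $z(v_2)$ with objective value $v_2$. 2. However the rescalings are placed, a corrector phase started at $X_2$ makes at most $K$ line searches in total. In each of its states $(X,\mathcal Y)$ the matrix $X$ is positive definite with $\langle A_i,X\rangle=b_i$ for $i\ge1$ and $\langle A_0,X\rangle=v_2$; if $\Delta(f^{\mathrm{FW}(k)}_{|L^\Psi_X(v_2)},\mathcal Y)>\frac1{14}$, then a line search from $\mathcal Y$ exists; and if $\Delta(f^{\mathrm{FW}(k)}_{|L^\Psi_X(v_2)},\mathcal Y_0)\le\frac1{14}$, then $\Delta(f^{\mathrm{SDP}}_{|L(v_2)},X)\le\frac19$ and $\Delta(f^{\mathrm{SDP}}_{|L_X(v_2)},I)\le\frac19$. 3. Consequently, within at most $K$ line searches a corrector phase can reach a state $(X,\mathcal Y_0)$ with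 $\Delta(f^{\mathrm{FW}(k)}_{|L^\Psi_X(v_2)},\mathcal Y_0)\le\frac1{14}$ and $\Delta(f^{\mathrm{SDP}}_{|L(v_2)},X)\le\frac19$, from which the next predictor step can be taken. -/

import Mathlib

open scoped MatrixOrder

noncomputable section

namespace FactorWidth

/-! ### Newton steps and Newton decrements of restricted functionals -/

section Newton

variable {E : Type*} [AddCommGroup E] [Module ℝ E]

/-- The second derivative `D²f(x)[u, w] = ⟨u, H(x) w⟩`, as an iterated directional derivative.
For a twice continuously differentiable `f` this is the Hessian form, i.e. the local inner
product `⟨u, w⟩_x`; no reference norm on `E` is needed. -/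
def hess (f : E → ℝ) (x u w : E) : ℝ :=
  lineDeriv ℝ (fun y => lineDeriv ℝ f y w) x u

/-- `s` is the Newton step at `x` of `f` restricted to the affine subspace `L`: it lies in the
direction of `L` and satisfies `⟨s, d⟩_x = -⟨g(x), d⟩` for all `d` in that direction. In other
words `s` is the `⟨·,·⟩_x`-orthogonal projection of `-H(x)⁻¹ g(x)` onto the direction of `L`. -/
def IsNewtonStep (f : E → ℝ) (L : AffineSubspace ℝ E) (x s : E) : Prop :=
  s ∈ L.direction ∧ ∀ d ∈ L.direction, hess f x s d = -lineDeriv ℝ f x d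

open Classical in
/-- The Newton step of `f` restricted to `L` (it exists and is unique where the Hessian form is
positive definite on the direction of `L`). -/
def newtonStep (f : E → ℝ) (L : AffineSubspace ℝ E) (x : E) : E :=
  if h : ∃ s, IsNewtonStep f L x s then h.choose else 0

/-- The Newton decrement `Δ(f|_L, x)`: the local norm at `x` of the restricted Newton step. -/
def newtonDecrement (f : E → ℝ) (L : AffineSubspace ℝ E) (x : E) : ℝ :=
  Real.sqrt (hess f x (newtonStep f L x) (newtonStep f L x))

end Newton

/-! ### The semidefinite program and its central path -/

/-- Real `n × n` matrices. -/
abbrev Mat (n : ℕ) : Type := Matrix (Fin n) (Fin n) ℝ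

/-- The trace inner product `⟨X, Y⟩ = tr (X Y)`. -/
def ip {n : ℕ} (X Y : Mat n) : ℝ := (X * Y).trace

/-- The barrier `f^SDP(X) = -log det X`. -/
def fSDP {n : ℕ} (X : Mat n) : ℝ := -Real.log X.det

/-- The affine subspace `L(v)` of symmetric matrices `X` with `⟨A₀, X⟩ = v` and
`⟨A i, X⟩ = b i` for all `i`. -/
def slice {n m : ℕ} (A₀ : Mat n) (A : Fin m → Mat n) (b : Fin m → ℝ) (v : ℝ) :
    AffineSubspace ℝ (Mat n) where
  carrier := {X | X.IsSymm ∧ ip A₀ X = v ∧ ∀ i, ip (A i) X = b i}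
  smul_vsub_vadd_mem' := by
    rintro c X Y Z ⟨hX, hX0, hX'⟩ ⟨hY, hY0, hY'⟩ ⟨hZ, hZ0, hZ'⟩
    refine ⟨((hX.sub hY).smul c).add hZ, ?_, fun i => ?_⟩
    · simp only [ip, vsub_eq_sub, vadd_eq_add, mul_add, mul_sub, Matrix.mul_smul,
        Matrix.trace_add, Matrix.trace_sub, Matrix.trace_smul] at *
      simp [hX0, hY0, hZ0]
    · simp only [ip, vsub_eq_sub, vadd_eq_add, mul_add, mul_sub, Matrix.mul_smul,
        Matrix.trace_add, Matrix.trace_sub, Matrix.trace_smul] at *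
      simp [hX' i, hY' i, hZ' i]

/-- `X` is strictly feasible: positive definite with `⟨A i, X⟩ = b i` for all `i`. -/
def StrictlyFeasible {n m : ℕ} (A : Fin m → Mat n) (b : Fin m → ℝ) (X : Mat n) : Prop :=
  X.PosDef ∧ ∀ i, ip (A i) X = b i

/-- `z` is the point with parameter `η` on the central path of
`inf {⟨A₀, X⟩ : ⟨A i, X⟩ = b i, X ⪰ 0}`. -/
def IsCentralPoint {n m : ℕ} (A₀ : Mat n) (A : Fin m → Mat n) (b : Fin m → ℝ)
    (η : ℝ) (z : Mat n) : Prop :=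
  0 < η ∧ StrictlyFeasible A b z ∧
    ∀ X, StrictlyFeasible A b X → η * ip A₀ z + fSDP z ≤ η * ip A₀ X + fSDP X

/-- `B` rescaled with respect to `X`: the matrix `X^{1/2} B X^{1/2}`. -/
def rescale {n : ℕ} (X B : Mat n) : Mat n := CFC.sqrt X * B * CFC.sqrt X

/-! ### Collections of `k × k` blocks -/

/-- The index set of the blocks: `k`-element subsets of `{1, …, n}`. -/
abbrev Idx (n k : ℕ) : Type := {J : Finset (Fin n) // J.card = k}

/-- Collections `𝒴 = (Y_J)` of `k × k` matrices, one for each `J`. -/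
abbrev Blocks (n k : ℕ) : Type := Idx n k → Matrix (Fin k) (Fin k) ℝ

/-- The `n × n` matrix `S_J^{→n}` with `S` as principal submatrix on `J` and zeros elsewhere. -/
def embed {n k : ℕ} (J : Idx n k) (S : Matrix (Fin k) (Fin k) ℝ) : Mat n :=
  fun i j => ∑ p, ∑ q,
    if i = J.1.orderEmbOfFin J.2 p ∧ j = J.1.orderEmbOfFin J.2 q then S p q else 0

/-- `Ψ(𝒴) = ∑_J Y_J^{→n}`. -/
def Psi {n k : ℕ} (Y : Blocks n k) : Mat n := ∑ J, embed J (Y J)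

/-- The right inverse `Ψ†` of `Ψ`: on the block `J` it divides the diagonal entries of `X_{J,J}`
by `C(n-1, k-1)` and the off-diagonal ones by `C(n-2, k-2)`. -/
def PsiDagger {n k : ℕ} (X : Mat n) : Blocks n k := fun J p q =>
  (if p = q then 1 / ((n - 1).choose (k - 1) : ℝ) else 1 / ((n - 2).choose (k - 2) : ℝ)) *
    X (J.1.orderEmbOfFin J.2 p) (J.1.orderEmbOfFin J.2 q)

/-- The collection `𝒴₀`, all of whose blocks are `C(n-1, k-1)⁻¹ I`. -/
def Y0 (n k : ℕ) : Blocks n k := fun _ => (1 / ((n - 1).choose (k - 1) : ℝ)) • 1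

/-- All blocks are positive definite: the interior of the product cone. -/
def BlocksPosDef {n k : ℕ} (Y : Blocks n k) : Prop := ∀ J, (Y J).PosDef

/-- All blocks are positive semidefinite: the product cone. -/
def BlocksPosSemidef {n k : ℕ} (Y : Blocks n k) : Prop := ∀ J, (Y J).PosSemidef

/-- The barrier `f^{FW(k)}(𝒴) = -∑_J log det Y_J`. -/
def fFW {n k : ℕ} (Y : Blocks n k) : ℝ := -∑ J, Real.log (Y J).det

/-- `Ψ` respects the affine combinations needed for `blockSlice`. -/
theorem Psi_smul_sub_add {n k : ℕ} (c : ℝ) (X Y Z : Blocks n k) :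
    Psi (c • (X - Y) + Z) = c • (Psi X - Psi Y) + Psi Z := by
  ext i j
  simp only [Psi, embed, Matrix.sum_apply, Matrix.add_apply, Matrix.smul_apply, Matrix.sub_apply,
    Pi.add_apply, Pi.smul_apply, Pi.sub_apply, smul_eq_mul, ← Finset.sum_sub_distrib,
    Finset.mul_sum, ← Finset.sum_add_distrib]
  refine Finset.sum_congr rfl fun J _ => Finset.sum_congr rfl fun p _ =>
    Finset.sum_congr rfl fun q _ => ?_
  split_ifs <;> ring

/-- The affine subspace `L^Ψ(v)` of collections `𝒴` of symmetric blocks such that `Ψ(𝒴)` lies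
in `L(v)`. -/
def blockSlice {n m : ℕ} (k : ℕ) (A₀ : Mat n) (A : Fin m → Mat n) (b : Fin m → ℝ) (v : ℝ) :
    AffineSubspace ℝ (Blocks n k) where
  carrier := {Y | (∀ J, (Y J).IsSymm) ∧ ip A₀ (Psi Y) = v ∧ ∀ i, ip (A i) (Psi Y) = b i}
  smul_vsub_vadd_mem' := by
    rintro c X Y Z ⟨hX, hX0, hX'⟩ ⟨hY, hY0, hY'⟩ ⟨hZ, hZ0, hZ'⟩
    refine ⟨fun J => (((hX J).sub (hY J)).smul c).add (hZ J), ?_, fun i => ?_⟩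
    · simp only [ip, vsub_eq_sub, vadd_eq_add, Psi_smul_sub_add, mul_add, mul_sub,
        Matrix.mul_smul, Matrix.trace_add, Matrix.trace_sub, Matrix.trace_smul] at *
      simp [hX0, hY0, hZ0]
    · simp only [ip, vsub_eq_sub, vadd_eq_add, Psi_smul_sub_add, mul_add, mul_sub,
        Matrix.mul_smul, Matrix.trace_add, Matrix.trace_sub, Matrix.trace_smul] at *
      simp [hX' i, hY' i, hZ' i]

/-! ### The two phases of the algorithm -/

/-- The space `L_ℓ(v)` for the data rescaled with respect to `X = X_ℓ`. -/
def sliceAt {n m : ℕ} (A₀ : Mat n) (A : Fin m → Mat n) (b : Fin m → ℝ) (v : ℝ) (X : Mat n) :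
    AffineSubspace ℝ (Mat n) :=
  slice (rescale X A₀) (fun i => rescale X (A i)) b v

/-- The space `L_ℓ^Ψ(v)` for the data rescaled with respect to `X = X_ℓ`. -/
def blockSliceAt {n m : ℕ} (k : ℕ) (A₀ : Mat n) (A : Fin m → Mat n) (b : Fin m → ℝ) (v : ℝ)
    (X : Mat n) : AffineSubspace ℝ (Blocks n k) :=
  blockSlice k (rescale X A₀) (fun i => rescale X (A i)) b v

/-- One predictor step with parameter `σ` takes `X` to `X'`. With the data rescaled with respect
to `X`, `y` solves `𝒜 A₀ = 𝒜 𝒜* y`, so that `𝒜* y - A₀` is minus the projection of `A₀` onto the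
null space of `𝒜`; the step from `𝒴₀` in the direction `𝒵 = Ψ†(𝒜* y - A₀)` covers the
fraction `σ` of the distance `s* = sup {s : 𝒴₀ + s 𝒵 ⪰ 0}` to the boundary of the product cone.
(If `𝒵 = 0`, the value of `s*` is immaterial and `X' = X`.) -/
def IsPredictorStep {n m : ℕ} (k : ℕ) (A₀ : Mat n) (A : Fin m → Mat n) (σ : ℝ)
    (X X' : Mat n) : Prop :=
  ∃ y : Fin m → ℝ,
    (∀ i, ip (rescale X (A i)) (∑ j, y j • rescale X (A j)) =
      ip (rescale X (A i)) (rescale X A₀)) ∧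
    let Z : Blocks n k := PsiDagger (∑ j, y j • rescale X (A j) - rescale X A₀)
    X' = rescale X (Psi (Y0 n k + (σ * sSup {s : ℝ | BlocksPosSemidef (Y0 n k + s • Z)}) • Z))

/-- `Y'` is obtained from `Y` by an exact line search for the barrier `f^{FW(k)}` along the
Newton step of its restriction to `L`. -/
def IsLineSearch {n k : ℕ} (L : AffineSubspace ℝ (Blocks n k)) (Y Y' : Blocks n k) : Prop :=
  ∃ t : ℝ, Y' = Y + t • newtonStep fFW L Y ∧ BlocksPosDef Y' ∧
    ∀ s : ℝ, BlocksPosDef (Y + s • newtonStep fFW L Y) →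
      fFW Y' ≤ fFW (Y + s • newtonStep fFW L Y)

/-- The states `(X, 𝒴)` that a corrector phase started at `X₂` with objective value `v` can reach,
together with the number `N` of line searches made so far. Here `X` is the matrix with respect to
which the data are currently rescaled and `𝒴` is the current point of the product cone. A line
search is made only while the Newton decrement of the restricted barrier `f^{FW(k)}` at `𝒴` exceeds
`1/14`; rescaling replaces `X` by `X^{1/2} Ψ(𝒴) X^{1/2}` and restarts from `𝒴₀`. When
to rescale is left open, so that both rescaling after each line search and rescaling only once the
decrement has dropped to `1/14` are covered. -/
inductive CorrectorRun {n m : ℕ} (k : ℕ) (A₀ : Mat n) (A : Fin m → Mat n) (b : Fin m → ℝ)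
    (v : ℝ) (X₂ : Mat n) : Mat n → Blocks n k → ℕ → Prop
  | start : CorrectorRun k A₀ A b v X₂ X₂ (Y0 n k) 0
  | lineSearch {X : Mat n} {Y Y' : Blocks n k} {N : ℕ} :
      CorrectorRun k A₀ A b v X₂ X Y N →
      1 / 14 < newtonDecrement fFW (blockSliceAt k A₀ A b v X) Y →
      IsLineSearch (blockSliceAt k A₀ A b v X) Y Y' →
      CorrectorRun k A₀ A b v X₂ X Y' (N + 1)
  | rescaling {X : Mat n} {Y : Blocks n k} {N : ℕ} :
      CorrectorRun k A₀ A b v X₂ X Y N →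
      CorrectorRun k A₀ A b v X₂ (rescale X (Psi Y)) (Y0 n k) N

end FactorWidth

end

/-! With respect to a point `z` of the central path, `⟨z⁻¹, X⟩ = n + η (⟨A₀, X⟩ - ⟨A₀, z⟩)` on the
affine hull of the feasible set. By Fenchel's inequality `n ≤ ⟨P, Q⟩ - log det P - log det Q` this
makes `z` a minimizer of the barrier among the strictly feasible points whose objective value is at
most `⟨A₀, z⟩`, and it makes the slices of the feasible set at prescribed objective values compact;
minimizing the barrier over a slice below `z` gives a central point again, with `η` obtained from
the Lagrange multiplier of the objective.

Line searches are counted by the potential `C fSDP X + (fFW 𝒴 - fFW 𝒴₀)`, where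
`C = (n - 1).choose (k - 1)`. Since `fFW` is self-concordant, a line search at a point of decrement
more than `1/14` decreases it by at least `1/1000`. Rescaling does not increase it, which amounts to
`C fSDP (Ψ 𝒴) ≤ fFW 𝒴 - fFW 𝒴₀`: as `k ∣ n`, the index set can be partitioned into `n / k` blocks,
and averaging Fenchel's inequality between `(Ψ 𝒴)⁻¹` and the corresponding block-diagonal matrices
over all permutations of the index set gives the factor `C`. Initially the potential exceeds its
lower bound `C fSDP (z v₂)` by at most `C (n log (1 / (1 - σ)) + 1 / 81)`: the predictor step moves
a fraction at most `σ` towards a positive semidefinite matrix, hence scales the determinant by at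
least `(1 - σ) ^ n`, and a Newton decrement of at most `1 / 9` puts `X₁` within `1 / 81` of the
minimum of the barrier over `L(v₁)`.

The stopping test transfers to `fSDP` because `Ψ†` is a right inverse of `Ψ` that does not
increase norms, so that testing the differential of `fFW` on `Ψ† S` bounds that of `fSDP` on `S`. -/

noncomputable section

namespace FactorWidth

open Matrix

section Spectral

variable {ι : Type*} [Fintype ι] {S P : Matrix ι ι ℝ}

theorem trace_mul_self_eq_sum_sq (hS : S.IsHermitian) : (S * S).trace = ∑ i, ∑ j, S i j ^ 2 := by
  simp only [trace, diag, mul_apply]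
  exact Finset.sum_congr rfl fun i _ => Finset.sum_congr rfl fun j _ => by
    rw [← (isHermitian_iff_isSymm.1 hS).apply j i, sq]

theorem trace_mul_self_nonneg (hS : S.IsHermitian) : 0 ≤ (S * S).trace := by
  rw [trace_mul_self_eq_sum_sq hS]
  positivity

theorem trace_mul_self_eq_zero_iff (hS : S.IsHermitian) : (S * S).trace = 0 ↔ S = 0 := by
  rw [← trace_conjTranspose_mul_self_eq_zero_iff, hS.eq]

variable [DecidableEq ι]

theorem trace_mul_self_eq_sum_sq_eigenvalues (hS : S.IsHermitian) :
    (S * S).trace = ∑ i, hS.eigenvalues i ^ 2 := by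
  conv_lhs => rw [hS.spectral_theorem, ← map_mul, Unitary.conjStarAlgAut_apply, trace_mul_comm,
    ← mul_assoc, Unitary.coe_star_mul_self, one_mul, diagonal_mul_diagonal, trace_diagonal]
  exact Finset.sum_congr rfl fun i _ => (sq _).symm

theorem sq_eigenvalues_le_trace_mul_self (hS : S.IsHermitian) (i : ι) :
    hS.eigenvalues i ^ 2 ≤ (S * S).trace := by
  rw [trace_mul_self_eq_sum_sq_eigenvalues hS]
  exact Finset.single_le_sum (fun j _ => sq_nonneg (hS.eigenvalues j)) (Finset.mem_univ i)

theorem one_add_eq_conjStarAlgAut (hS : S.IsHermitian) :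
    1 + S = Unitary.conjStarAlgAut ℝ _ hS.eigenvectorUnitary
      (diagonal fun i => 1 + hS.eigenvalues i) := by
  conv_lhs => rw [hS.spectral_theorem, ← map_one (Unitary.conjStarAlgAut ℝ _ hS.eigenvectorUnitary),
    ← map_add, ← diagonal_one, diagonal_add]
  rfl

theorem det_one_add_eq_prod_eigenvalues (hS : S.IsHermitian) :
    (1 + S).det = ∏ i, (1 + hS.eigenvalues i) := by
  rw [one_add_eq_conjStarAlgAut hS, Unitary.conjStarAlgAut_apply, det_mul_right_comm,
    Unitary.mul_star_self_of_mem (SetLike.coe_mem _), one_mul, det_diagonal]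

theorem posDef_one_add (hS : S.IsHermitian) (h : (S * S).trace < 1) : (1 + S).PosDef := by
  rw [one_add_eq_conjStarAlgAut hS, Unitary.conjStarAlgAut_apply,
    IsUnit.posDef_star_right_conjugate_iff (Unitary.isUnit_coe), posDef_diagonal_iff]
  intro i
  have hi := (sq_eigenvalues_le_trace_mul_self hS i).trans_lt h
  linarith [(abs_lt.1 (sq_lt_one_iff_abs_lt_one _ |>.1 hi)).1]

theorem log_det_le_trace_sub_card (hP : P.PosDef) :
    Real.log P.det ≤ P.trace - Fintype.card ι := by
  rw [hP.1.det_eq_prod_eigenvalues, hP.1.trace_eq_sum_eigenvalues]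
  calc Real.log (∏ i, hP.1.eigenvalues i) = ∑ i, Real.log (hP.1.eigenvalues i) :=
        Real.log_prod fun i _ => (hP.eigenvalues_pos i).ne'
    _ ≤ ∑ i, (hP.1.eigenvalues i - 1) :=
        Finset.sum_le_sum fun i _ => Real.log_le_sub_one_of_pos (hP.eigenvalues_pos i)
    _ = ∑ i, hP.1.eigenvalues i - Fintype.card ι := by simp [Finset.sum_sub_distrib]

theorem sub_sq_le_log_one_add {x : ℝ} (hx : |x| ≤ 1 / 3) : x - x ^ 2 ≤ Real.log (1 + x) := by
  have htaylor := Real.abs_log_sub_add_sum_range_le (x := -x) (by rw [abs_neg]; linarith) 2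
  have hremainder : |x| ^ 3 / (1 - |x|) ≤ x ^ 2 / 2 := by
    rw [div_le_iff₀ (by linarith), ← sq_abs x]
    nlinarith [mul_nonneg (sq_nonneg |x|) (sub_nonneg.2 hx)]
  simp only [Finset.sum_range_succ, Finset.sum_range_zero, abs_neg, sub_neg_eq_add] at htaylor
  norm_num at htaylor
  linarith [(abs_le.1 (htaylor.trans hremainder)).1]

theorem trace_sub_trace_mul_self_le_log_det (hS : S.IsHermitian) (h : (S * S).trace ≤ 1 / 9) :
    S.trace - (S * S).trace ≤ Real.log (1 + S).det := by
  have hle (i : ι) : |hS.eigenvalues i| ≤ 1 / 3 :=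
    abs_le_of_sq_le_sq (by linarith [sq_eigenvalues_le_trace_mul_self hS i]) (by norm_num)
  have hpos (i : ι) : 0 < 1 + hS.eigenvalues i := by linarith [(abs_le.1 (hle i)).1]
  rw [det_one_add_eq_prod_eigenvalues hS, Real.log_prod fun i _ => (hpos i).ne',
    trace_mul_self_eq_sum_sq_eigenvalues hS, hS.trace_eq_sum_eigenvalues,
    ← Finset.sum_sub_distrib]
  exact Finset.sum_le_sum fun i _ => sub_sq_le_log_one_add (hle i)

end Spectral

section InnerProduct

variable {n : ℕ}

theorem ip_comm (X Y : Mat n) : ip X Y = ip Y X := trace_mul_comm X Y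

theorem ip_add (X Y Z : Mat n) : ip X (Y + Z) = ip X Y + ip X Z := by
  rw [ip, mul_add, trace_add, ip, ip]

theorem ip_sub (X Y Z : Mat n) : ip X (Y - Z) = ip X Y - ip X Z := by
  rw [ip, mul_sub, trace_sub, ip, ip]

theorem ip_smul (c : ℝ) (X Y : Mat n) : ip X (c • Y) = c * ip X Y := by
  rw [ip, mul_smul_comm, trace_smul, smul_eq_mul, ip]

theorem ip_sum {ι : Type*} (X : Mat n) (s : Finset ι) (Y : ι → Mat n) :
    ip X (∑ i ∈ s, Y i) = ∑ i ∈ s, ip X (Y i) := by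
  rw [ip, Finset.mul_sum, trace_sum]
  rfl

theorem continuous_ip (X : Mat n) : Continuous (ip X) := by
  unfold ip
  fun_prop

end InnerProduct

section Rescale

variable {n : ℕ} {X B : Mat n}

theorem sqrt_mul_sqrt (hX : X.PosDef) : CFC.sqrt X * CFC.sqrt X = X :=
  CFC.sqrt_mul_sqrt_self X hX.posSemidef.nonneg

theorem isHermitian_sqrt (X : Mat n) : (CFC.sqrt X).IsHermitian :=
  (CFC.sqrt_nonneg X).posSemidef.1

theorem isUnit_sqrt (hX : X.PosDef) : IsUnit (CFC.sqrt X) :=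
  isUnit_of_mul_isUnit_left ((sqrt_mul_sqrt hX).symm ▸ hX.isUnit)

theorem sqrt_inv (hX : X.PosDef) : CFC.sqrt X⁻¹ = (CFC.sqrt X)⁻¹ := by
  refine CFC.sqrt_unique ?_ (CFC.sqrt_nonneg X).posSemidef.inv.nonneg
  rw [← Matrix.mul_inv_rev, sqrt_mul_sqrt hX]

theorem rescale_add (X A B : Mat n) : rescale X (A + B) = rescale X A + rescale X B := by
  rw [rescale, mul_add, add_mul, rescale, rescale]

theorem rescale_smul (c : ℝ) (X B : Mat n) : rescale X (c • B) = c • rescale X B := by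
  rw [rescale, mul_smul_comm, smul_mul_assoc, rescale]

theorem rescale_one (hX : X.PosDef) : rescale X 1 = X := by
  rw [rescale, mul_one, sqrt_mul_sqrt hX]

theorem rescale_rescale_inv (hX : X.PosDef) (B : Mat n) : rescale X (rescale X⁻¹ B) = B := by
  have hdet := (isUnit_iff_isUnit_det _).1 (isUnit_sqrt hX)
  simp only [rescale, sqrt_inv hX, mul_assoc, nonsing_inv_mul _ hdet, mul_one,
    mul_nonsing_inv_cancel_left _ _ hdet]

theorem rescale_inv_rescale (hX : X.PosDef) (B : Mat n) : rescale X⁻¹ (rescale X B) = B := by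
  simpa only [nonsing_inv_nonsing_inv X ((isUnit_iff_isUnit_det X).1 hX.isUnit)] using
    rescale_rescale_inv hX.inv B

theorem rescale_inv_self (hX : X.PosDef) : rescale X⁻¹ X = 1 := by
  simpa only [rescale_one hX] using rescale_inv_rescale hX 1

theorem isSymm_rescale (X : Mat n) (hB : B.IsSymm) : (rescale X B).IsSymm := by
  have hsqrt := isHermitian_iff_isSymm.1 (isHermitian_sqrt X)
  simp only [rescale, IsSymm, transpose_mul, hsqrt.eq, hB.eq, mul_assoc]

theorem posDef_rescale_iff (hX : X.PosDef) : (rescale X B).PosDef ↔ B.PosDef := by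
  have h := IsUnit.posDef_star_left_conjugate_iff (x := B) (isUnit_sqrt hX)
  rwa [star_eq_conjTranspose, (isHermitian_sqrt X).eq] at h

theorem det_rescale (hX : X.PosDef) (B : Mat n) : (rescale X B).det = X.det * B.det := by
  rw [rescale, det_mul_right_comm, sqrt_mul_sqrt hX, det_mul]

theorem fSDP_rescale (hX : X.PosDef) (hB : B.PosDef) :
    fSDP (rescale X B) = fSDP X + fSDP B := by
  rw [fSDP, det_rescale hX, Real.log_mul hX.det_pos.ne' hB.det_pos.ne', neg_add, fSDP, fSDP]

theorem ip_rescale (X A B : Mat n) : ip A (rescale X B) = ip (rescale X A) B := by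
  rw [ip, rescale, ← mul_assoc, trace_mul_comm, ip, rescale]
  simp only [mul_assoc]

theorem trace_rescale (hX : X.PosDef) (B : Mat n) : (rescale X B).trace = ip X B := by
  rw [rescale, trace_mul_cycle, sqrt_mul_sqrt hX, ip]

end Rescale

section Barrier

variable {n : ℕ} {P Q X S : Mat n}

theorem natCast_le_ip_add_fSDP_add_fSDP (hP : P.PosDef) (hQ : Q.PosDef) :
    n ≤ ip P Q + fSDP P + fSDP Q := by
  have h := log_det_le_trace_sub_card ((posDef_rescale_iff hP).2 hQ)
  rw [trace_rescale hP, Fintype.card_fin] at h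
  have hdet := fSDP_rescale hP hQ
  rw [fSDP] at hdet
  linarith

theorem fSDP_inv (hX : X.PosDef) : fSDP X⁻¹ = -fSDP X := by
  have h := fSDP_rescale hX.inv hX
  rw [rescale_inv_self hX, fSDP, det_one, Real.log_one] at h
  linarith

/-- The differential `U ↦ -⟨X⁻¹, U⟩` of the barrier `fSDP` at `X`. -/
def gradSDP (X : Mat n) : Mat n →ₗ[ℝ] ℝ :=
  -(traceLinearMap (Fin n) ℝ ℝ ∘ₗ LinearMap.mulLeft ℝ X⁻¹)

theorem gradSDP_apply (X U : Mat n) : gradSDP X U = -ip X⁻¹ U := rfl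

/-- The local inner product `⟨U, W⟩_X = tr (X⁻¹ U X⁻¹ W)` of the barrier `fSDP` at `X`. -/
def localForm (X : Mat n) : LinearMap.BilinForm ℝ (Mat n) :=
  ((LinearMap.mul ℝ (Mat n)).compr₂ (traceLinearMap (Fin n) ℝ ℝ)).compl₁₂
    (LinearMap.mulLeft ℝ X⁻¹) (LinearMap.mulLeft ℝ X⁻¹)

theorem localForm_apply (X U W : Mat n) : localForm X U W = (X⁻¹ * U * (X⁻¹ * W)).trace := rfl

theorem localForm_eq_ip_rescale (hX : X.PosDef) (U W : Mat n) :
    localForm X U W = ip (rescale X⁻¹ U) (rescale X⁻¹ W) := by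
  rw [localForm_apply, ip, rescale, rescale]
  generalize hR : CFC.sqrt X⁻¹ = R
  rw [← sqrt_mul_sqrt hX.inv, hR, mul_assoc (_ * _), mul_assoc R R, trace_mul_comm]
  simp only [mul_assoc]

theorem localForm_one (U W : Mat n) : localForm 1 U W = ip U W := by
  rw [localForm_apply, inv_one, one_mul, one_mul, ip]

theorem localForm_isSymm (X : Mat n) : (localForm X).IsSymm :=
  ⟨fun U W => trace_mul_comm (X⁻¹ * U) (X⁻¹ * W)⟩

theorem localForm_self_nonneg (hX : X.PosDef) (hS : S.IsSymm) : 0 ≤ localForm X S S := by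
  rw [localForm_eq_ip_rescale hX]
  exact trace_mul_self_nonneg (isHermitian_iff_isSymm.2 (isSymm_rescale _ hS))

theorem localForm_self_eq_zero_iff (hX : X.PosDef) (hS : S.IsSymm) :
    localForm X S S = 0 ↔ S = 0 := by
  rw [localForm_eq_ip_rescale hX]
  refine (trace_mul_self_eq_zero_iff (isHermitian_iff_isSymm.2 (isSymm_rescale _ hS))).trans
    ⟨fun h => ?_, fun h => by rw [h, rescale, mul_zero, zero_mul]⟩
  rw [← rescale_rescale_inv hX S, h, rescale, mul_zero, zero_mul]

theorem posDef_add (hX : X.PosDef) (hS : S.IsSymm) (h : localForm X S S < 1) :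
    (X + S).PosDef := by
  rw [← posDef_rescale_iff hX.inv, rescale_add, rescale_inv_self hX]
  rw [localForm_eq_ip_rescale hX] at h
  exact posDef_one_add (isHermitian_iff_isSymm.2 (isSymm_rescale _ hS)) h

theorem fSDP_add_le (hX : X.PosDef) (hS : S.IsSymm) (h : localForm X S S ≤ 1 / 9) :
    fSDP (X + S) ≤ fSDP X + gradSDP X S + localForm X S S := by
  have hXS := posDef_add hX hS (h.trans_lt (by norm_num))
  rw [localForm_eq_ip_rescale hX] at h ⊢
  have hlog := trace_sub_trace_mul_self_le_log_det
    (isHermitian_iff_isSymm.2 (isSymm_rescale X⁻¹ hS)) h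
  have hdet := fSDP_rescale hX.inv hXS
  rw [rescale_add, rescale_inv_self hX, fSDP_inv hX, fSDP] at hdet
  rw [trace_rescale hX.inv] at hlog
  rw [gradSDP_apply, ip.eq_1 (rescale _ _)]
  linarith

end Barrier

section Derivatives

variable {n : ℕ} {X : Mat n}

theorem hasDerivAt_det_one_add_smul (U : Mat n) :
    HasDerivAt (fun t : ℝ => (1 + t • U).det) U.trace 0 := by
  have hpoly (t : ℝ) := det_one_add_smul t U
  simp only [hpoly]
  have hlin : HasDerivAt (fun t : ℝ => 1 + U.trace * t) U.trace 0 := by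
    simpa using ((hasDerivAt_id (0 : ℝ)).const_mul U.trace).const_add 1
  have hsq : HasDerivAt (fun t : ℝ => t ^ 2) 0 0 := by simpa using hasDerivAt_pow 2 (0 : ℝ)
  simpa using hlin.fun_add ((Polynomial.hasDerivAt _ (0 : ℝ)).fun_mul hsq)

theorem hasDerivAt_fSDP (hX : X.det ≠ 0) (U : Mat n) :
    HasDerivAt (fun t : ℝ => fSDP (X + t • U)) (gradSDP X U) 0 := by
  have hdet (t : ℝ) : (X + t • U).det = X.det * (1 + t • (X⁻¹ * U)).det := by
    rw [← det_mul, mul_add, mul_one, mul_smul_comm,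
      mul_nonsing_inv_cancel_left _ _ (isUnit_iff_ne_zero.2 hX)]
  simp only [fSDP, hdet]
  have hlog := (((hasDerivAt_det_one_add_smul (X⁻¹ * U)).const_mul X.det).log (by simpa)).fun_neg
  simpa [mul_div_cancel_left₀ _ hX, gradSDP_apply, ip] using hlog

theorem lineDeriv_fSDP (hX : X.det ≠ 0) (U : Mat n) : lineDeriv ℝ fSDP X U = gradSDP X U :=
  (hasDerivAt_fSDP hX U).deriv

theorem hasDerivAt_gradSDP (hX : X.det ≠ 0) (U W : Mat n) :
    HasDerivAt (fun t : ℝ => gradSDP (X + t • U) W) (localForm X U W) 0 := by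
  let _ : NormedRing (Mat n) := Matrix.linftyOpNormedRing
  let _ : NormedAlgebra ℝ (Mat n) := Matrix.linftyOpNormedAlgebra
  obtain ⟨x, rfl⟩ := (isUnit_iff_isUnit_det X).2 (isUnit_iff_ne_zero.2 hX)
  have hline : HasDerivAt (fun t : ℝ => (x : Mat n) + t • U) U 0 := by
    have hsmul := (hasDerivAt_id (0 : ℝ)).smul_const U
    simp only [one_smul] at hsmul
    exact hsmul.const_add _
  have hinv := (hasFDerivAt_ringInverse (𝕜 := ℝ) x).comp_hasDerivAt_of_eq 0 hline (by simp)
  have htrace := ((traceLinearMap (Fin n) ℝ ℝ ∘ₗ LinearMap.mulRight ℝ W).toContinuousLinearMap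
    |>.hasFDerivAt).comp_hasDerivAt 0 hinv
  simp only [gradSDP_apply, ip, nonsing_inv_eq_ringInverse]
  refine htrace.fun_neg.congr_deriv ?_
  change -((-ContinuousLinearMap.mulLeftRight ℝ (Mat n) ↑x⁻¹ ↑x⁻¹) U * W).trace = _
  simp [localForm_apply, mul_assoc]

theorem eventually_det_add_smul_ne_zero (hX : X.det ≠ 0) (U : Mat n) :
    ∀ᶠ t : ℝ in nhds 0, (X + t • U).det ≠ 0 := by
  have hcont : Continuous fun t : ℝ => (X + t • U).det := by fun_prop
  exact hcont.continuousAt.eventually_ne (by simpa)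

theorem hess_fSDP (hX : X.det ≠ 0) (U W : Mat n) : hess fSDP X U W = localForm X U W := by
  have heq : (fun t : ℝ => lineDeriv ℝ fSDP (X + t • U) W) =ᶠ[nhds 0]
      fun t => gradSDP (X + t • U) W :=
    (eventually_det_add_smul_ne_zero hX U).mono fun t ht => lineDeriv_fSDP ht W
  exact heq.deriv_eq.trans (hasDerivAt_gradSDP hX U W).deriv

end Derivatives

section Newton

variable {E : Type*} [AddCommGroup E] [Module ℝ E]

/-- At `x`, the functional `f` has differential `g` and second derivative `H`, and `H` is positive
definite on the direction of `L`: the setting in which the Newton step of `f` restricted to `L`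
exists. -/
structure HasPosDefHessian (f : E → ℝ) (L : AffineSubspace ℝ E) (x : E) (g : E →ₗ[ℝ] ℝ)
    (H : LinearMap.BilinForm ℝ E) : Prop where
  lineDeriv_eq (d : E) : lineDeriv ℝ f x d = g d
  hess_eq (u w : E) : hess f x u w = H u w
  isSymm : H.IsSymm
  pos (d : E) : d ∈ L.direction → d ≠ 0 → 0 < H d d

namespace HasPosDefHessian

variable {f : E → ℝ} {L : AffineSubspace ℝ E} {x : E} {g : E →ₗ[ℝ] ℝ}
  {H : LinearMap.BilinForm ℝ E}

theorem self_nonneg (h : HasPosDefHessian f L x g H) {d : E} (hd : d ∈ L.direction) :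
    0 ≤ H d d := by
  obtain rfl | hd0 := eq_or_ne d 0
  · simp
  · exact (h.pos d hd hd0).le

theorem nondegenerate_restrict (h : HasPosDefHessian f L x g H) :
    (H.restrict L.direction).Nondegenerate := by
  constructor <;> intro d hd <;> by_contra hd0 <;>
    exact (h.pos d d.2 (by simpa using hd0)).ne' (hd d)

variable [FiniteDimensional ℝ E]

theorem isNewtonStep_newtonStep (h : HasPosDefHessian f L x g H) :
    IsNewtonStep f L x (newtonStep f L x) := by
  let s := ((H.restrict L.direction).toDual h.nondegenerate_restrict).symm (-g.domRestrict _)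
  have hs : ∃ s, IsNewtonStep f L x s := by
    refine ⟨s, s.2, fun d hd => ?_⟩
    rw [h.hess_eq, h.lineDeriv_eq]
    exact LinearMap.BilinForm.apply_toDual_symm_apply (hB := h.nondegenerate_restrict)
      (-g.domRestrict _) ⟨d, hd⟩
  rw [newtonStep, dif_pos hs]
  exact hs.choose_spec

theorem newtonStep_mem (h : HasPosDefHessian f L x g H) : newtonStep f L x ∈ L.direction :=
  h.isNewtonStep_newtonStep.1

theorem apply_newtonStep (h : HasPosDefHessian f L x g H) {d : E} (hd : d ∈ L.direction) :
    H (newtonStep f L x) d = -g d := by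
  rw [← h.hess_eq, ← h.lineDeriv_eq, h.isNewtonStep_newtonStep.2 d hd]

theorem sq_newtonDecrement (h : HasPosDefHessian f L x g H) :
    newtonDecrement f L x ^ 2 = H (newtonStep f L x) (newtonStep f L x) := by
  rw [newtonDecrement, h.hess_eq, Real.sq_sqrt (h.self_nonneg h.newtonStep_mem)]

theorem apply_gradient_newtonStep (h : HasPosDefHessian f L x g H) :
    g (newtonStep f L x) = -newtonDecrement f L x ^ 2 := by
  rw [h.sq_newtonDecrement, h.apply_newtonStep h.newtonStep_mem, neg_neg]

theorem sq_apply_le (h : HasPosDefHessian f L x g H) {d : E} (hd : d ∈ L.direction) :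
    g d ^ 2 ≤ newtonDecrement f L x ^ 2 * H d d := by
  have hcs := (H.restrict L.direction).apply_sq_le_of_symm (fun d => h.self_nonneg d.2)
    ⟨fun u w => h.isSymm.eq u w⟩ ⟨_, h.newtonStep_mem⟩ ⟨d, hd⟩
  simpa only [LinearMap.BilinForm.restrict_apply, LinearMap.domRestrict_apply,
    h.apply_newtonStep hd, neg_sq, ← h.sq_newtonDecrement] using hcs

theorem newtonDecrement_le (h : HasPosDefHessian f L x g H) {c : ℝ} (hc : 0 ≤ c)
    (hle : ∀ d ∈ L.direction, g d ^ 2 ≤ c ^ 2 * H d d) : newtonDecrement f L x ≤ c := by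
  have hstep := hle _ h.newtonStep_mem
  rw [h.apply_gradient_newtonStep, ← h.sq_newtonDecrement, neg_sq, sq (_ ^ 2)] at hstep
  by_contra! hlt
  have hpos : 0 < newtonDecrement f L x ^ 2 := pow_pos (hc.trans_lt hlt) 2
  exact (pow_lt_pow_left₀ hlt hc two_ne_zero).not_ge (le_of_mul_le_mul_right hstep hpos)

end HasPosDefHessian

theorem newtonDecrement_nonneg (f : E → ℝ) (L : AffineSubspace ℝ E) (x : E) :
    0 ≤ newtonDecrement f L x :=
  Real.sqrt_nonneg _

end Newton

section BlockMaps

variable {n k : ℕ}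

/-- The increasing enumeration of `J`, which places a `k × k` block on the rows and columns in
`J`. -/
abbrev emb (J : Idx n k) : Fin k ↪o Fin n := J.1.orderEmbOfFin J.2

/-- The `k × n` matrix that selects the coordinates in `J`; conjugation by it turns `embed J` and
the restriction to the principal submatrix on `J` into products. -/
def sel (J : Idx n k) : Matrix (Fin k) (Fin n) ℝ := (1 : Mat n).submatrix (emb J) id

theorem embed_eq (J : Idx n k) (S : Mat k) : embed J S = (sel J)ᴴ * S * sel J := by
  ext i j
  simp only [embed, sel, mul_apply, conjTranspose_apply, Finset.sum_mul]
  rw [Finset.sum_comm]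
  refine Finset.sum_congr rfl fun q _ => Finset.sum_congr rfl fun p _ => ?_
  by_cases hi : i = emb J p <;> by_cases hj : j = emb J q <;> simp [one_apply, hi, hj, eq_comm]

theorem sel_mul_mul (J : Idx n k) (M : Mat n) :
    sel J * M * (sel J)ᴴ = M.submatrix (emb J) (emb J) := by
  rw [sel, conjTranspose_submatrix, conjTranspose_one, ← M.submatrix_id_id,
    ← submatrix_mul _ _ _ _ _ Function.bijective_id, one_mul,
    ← submatrix_mul _ _ _ _ _ Function.bijective_id, mul_one, M.submatrix_id_id]

theorem ip_embed (J : Idx n k) (M : Mat n) (S : Mat k) :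
    ip M (embed J S) = ip (M.submatrix (emb J) (emb J)) S := by
  rw [ip, ip, embed_eq, ← sel_mul_mul, ← Matrix.mul_assoc, trace_mul_comm]
  simp only [Matrix.mul_assoc]

theorem ip_Psi (M : Mat n) (Y : Blocks n k) :
    ip M (Psi Y) = ∑ J, ip (M.submatrix (emb J) (emb J)) (Y J) := by
  simp only [Psi, ip_sum, ip_embed]

theorem Psi_add (Y W : Blocks n k) : Psi (Y + W) = Psi Y + Psi W := by
  simp only [Psi, embed_eq, Pi.add_apply, Matrix.mul_add, Matrix.add_mul, Finset.sum_add_distrib]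

theorem Psi_smul (c : ℝ) (Y : Blocks n k) : Psi (c • Y) = c • Psi Y := by
  simp only [Psi, embed_eq, Pi.smul_apply, Matrix.mul_smul, Matrix.smul_mul, Finset.smul_sum]

theorem isSymm_Psi {Y : Blocks n k} (hY : ∀ J, (Y J).IsSymm) : (Psi Y).IsSymm := by
  refine isHermitian_iff_isSymm.1 (isSelfAdjoint_sum (R := Mat n) _ fun J _ => ?_)
  rw [embed_eq]
  exact isHermitian_conjTranspose_mul_mul _ (isHermitian_iff_isSymm.2 (hY J))

theorem Psi_posSemidef {Y : Blocks n k} (hY : BlocksPosSemidef Y) : (Psi Y).PosSemidef :=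
  posSemidef_sum _ fun J _ => by
    rw [embed_eq]
    exact (hY J).conjTranspose_mul_mul_same _

theorem card_filter_subset (T : Finset (Fin n)) (hT : T.card ≤ k) :
    (Finset.univ.filter fun J : Idx n k => T ⊆ J.1).card =
      (n - T.card).choose (k - T.card) := by
  have hcard := Finset.card_filter_powersetCard_subset T .univ k (Finset.subset_univ _) hT
  rw [Finset.card_univ, Fintype.card_fin] at hcard
  rw [← hcard]
  refine Finset.card_bij (fun J _ => J.1) (fun J hJ => by simpa [J.2] using hJ)
    (fun J _ J' _ h => Subtype.ext h) fun S hS => ?_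
  simp only [Finset.mem_filter, Finset.mem_powersetCard] at hS
  exact ⟨⟨S, hS.1.2⟩, by simpa using hS.2, rfl⟩

theorem emb_mem (J : Idx n k) (p : Fin k) : emb J p ∈ J.1 := Finset.orderEmbOfFin_mem _ _ _

theorem exists_emb_eq {J : Idx n k} {i : Fin n} (hi : i ∈ J.1) : ∃ p, emb J p = i :=
  (Finset.range_orderEmbOfFin J.1 J.2).ge hi

theorem embed_apply_emb (J : Idx n k) (S : Mat k) (p q : Fin k) :
    embed J S (emb J p) (emb J q) = S p q := by
  simp [embed, ite_and]

theorem embed_apply_of_not_subset {J : Idx n k} {i j : Fin n} (hij : ¬{i, j} ⊆ J.1) (S : Mat k) :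
    embed J S i j = 0 := by
  refine Finset.sum_eq_zero fun p _ => Finset.sum_eq_zero fun q _ => if_neg ?_
  rintro ⟨rfl, rfl⟩
  exact hij (Finset.insert_subset (emb_mem J p) (Finset.singleton_subset_iff.2 (emb_mem J q)))

theorem embed_submatrix_apply (J : Idx n k) (M : Mat n) (i j : Fin n) :
    embed J (M.submatrix (emb J) (emb J)) i j = if {i, j} ⊆ J.1 then M i j else 0 := by
  split_ifs with hij
  · obtain ⟨p, rfl⟩ := exists_emb_eq (hij (by simp) : i ∈ J.1)
    obtain ⟨q, rfl⟩ := exists_emb_eq (hij (by simp) : j ∈ J.1)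
    exact embed_apply_emb J _ p q
  · exact embed_apply_of_not_subset hij _

theorem choose_pos_cast (hkn : k ≤ n) : (0 : ℝ) < ((n - 1).choose (k - 1) : ℝ) := by
  exact_mod_cast Nat.choose_pos (Nat.sub_le_sub_right hkn 1)

theorem Psi_PsiDagger (hk : 2 ≤ k) (hkn : k ≤ n) (X : Mat n) :
    Psi (PsiDagger X : Blocks n k) = X := by
  ext i j
  let W : Mat n := .of fun i j => (if i = j then 1 / ((n - 1).choose (k - 1) : ℝ)
    else 1 / ((n - 2).choose (k - 2) : ℝ)) * X i j
  have hW (J : Idx n k) : (PsiDagger X : Blocks n k) J = W.submatrix (emb J) (emb J) := by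
    ext p q
    simp only [PsiDagger, W, submatrix_apply, of_apply, EmbeddingLike.apply_eq_iff_eq]
  have hcount : Psi (PsiDagger X : Blocks n k) i j =
      ((Finset.univ.filter fun J : Idx n k => {i, j} ⊆ J.1).card : ℝ) * W i j := by
    simp only [Psi, hW, Matrix.sum_apply, embed_submatrix_apply, Finset.sum_ite, Finset.sum_const,
      smul_zero, add_zero, nsmul_eq_mul]
  rw [hcount, card_filter_subset _ (Finset.card_le_two.trans hk)]
  obtain rfl | hij := eq_or_ne i j
  · simp [W, (choose_pos_cast hkn).ne']
  · have hchoose : ((n - 2).choose (k - 2) : ℝ) ≠ 0 := by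
      exact_mod_cast (Nat.choose_pos (Nat.sub_le_sub_right hkn 2)).ne'
    simp [W, hij, Finset.card_pair hij, hchoose]

theorem PsiDagger_one : PsiDagger (1 : Mat n) = Y0 n k := by
  ext J p q
  by_cases hpq : p = q <;> simp [PsiDagger, Y0, one_apply, hpq]

theorem Psi_Y0 (hk : 2 ≤ k) (hkn : k ≤ n) : Psi (Y0 n k) = 1 := by
  rw [← PsiDagger_one, Psi_PsiDagger hk hkn]

theorem isSymm_PsiDagger {X : Mat n} (hX : X.IsSymm) (J : Idx n k) :
    ((PsiDagger X : Blocks n k) J).IsSymm :=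
  IsSymm.ext fun p q => by simp only [PsiDagger, hX.apply, eq_comm]

theorem Y0_posDef (hkn : k ≤ n) : BlocksPosDef (Y0 n k) := fun _ =>
  PosDef.one.smul (one_div_pos.2 (choose_pos_cast hkn))

theorem BlocksPosDef.isSymm {Y : Blocks n k} (hY : BlocksPosDef Y) (J : Idx n k) :
    (Y J).IsSymm :=
  isHermitian_iff_isSymm.1 (hY J).1

theorem dotProduct_embed_mulVec (J : Idx n k) (S : Mat k) (x : Fin n → ℝ) :
    star x ⬝ᵥ (embed J S *ᵥ x) = star (sel J *ᵥ x) ⬝ᵥ (S *ᵥ (sel J *ᵥ x)) := by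
  rw [embed_eq, star_mulVec, ← dotProduct_mulVec, mulVec_mulVec, mulVec_mulVec, Matrix.mul_assoc]

theorem sel_mulVec (J : Idx n k) (x : Fin n → ℝ) (p : Fin k) : (sel J *ᵥ x) p = x (emb J p) := by
  simp [sel, mulVec, dotProduct, one_apply]

theorem Psi_posDef (hk : 0 < k) (hkn : k ≤ n) {Y : Blocks n k} (hY : BlocksPosDef Y) :
    (Psi Y).PosDef := by
  refine PosDef.of_dotProduct_mulVec_pos (Psi_posSemidef fun J => (hY J).posSemidef).1
    fun x hx => ?_
  rw [Psi, sum_mulVec, dotProduct_sum]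
  obtain ⟨i, hi⟩ := Function.ne_iff.1 hx
  obtain ⟨J, hiJ, -, hJ⟩ := Finset.exists_subsuperset_card_eq (n := k)
    (Finset.subset_univ {i}) (by simpa using Nat.succ_le_of_lt hk) (by simpa using hkn)
  refine Finset.sum_pos' (fun J _ => ?_) ⟨⟨J, hJ⟩, Finset.mem_univ _, ?_⟩ <;>
    rw [dotProduct_embed_mulVec]
  · exact (hY J).posSemidef.dotProduct_mulVec_nonneg _
  · refine (hY _).dotProduct_mulVec_pos fun hzero => hi ?_
    obtain ⟨p, rfl⟩ := exists_emb_eq (J := ⟨J, hJ⟩) (hiJ (Finset.mem_singleton_self i))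
    exact (sel_mulVec _ x p).symm.trans (congrFun hzero p)

end BlockMaps

section BlockBarrier

variable {n k : ℕ} {Y S : Blocks n k}

theorem fFW_eq_sum (Y : Blocks n k) : fFW Y = ∑ J, fSDP (Y J) := by
  simp only [fFW, fSDP, Finset.sum_neg_distrib]

/-- The differential of the barrier `fFW` at `Y`. -/
def gradFW (Y : Blocks n k) : Blocks n k →ₗ[ℝ] ℝ :=
  ∑ J, gradSDP (Y J) ∘ₗ LinearMap.proj J

theorem gradFW_apply (Y U : Blocks n k) : gradFW Y U = ∑ J, gradSDP (Y J) (U J) := by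
  simp only [gradFW, LinearMap.sum_apply, LinearMap.comp_apply, LinearMap.proj_apply]

/-- The local inner product of the barrier `fFW` at `Y`: the sum of the local inner products of
the blocks. -/
def blockForm (Y : Blocks n k) : LinearMap.BilinForm ℝ (Blocks n k) :=
  ∑ J, (localForm (Y J)).compl₁₂ (LinearMap.proj J) (LinearMap.proj J)

theorem blockForm_apply (Y U W : Blocks n k) :
    blockForm Y U W = ∑ J, localForm (Y J) (U J) (W J) := by
  simp only [blockForm, LinearMap.sum_apply, LinearMap.compl₁₂_apply, LinearMap.proj_apply]

theorem localForm_le_blockForm (hY : BlocksPosDef Y) (hS : ∀ J, (S J).IsSymm) (J : Idx n k) :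
    localForm (Y J) (S J) (S J) ≤ blockForm Y S S := by
  rw [blockForm_apply]
  exact Finset.single_le_sum (f := fun J => localForm (Y J) (S J) (S J))
    (fun J _ => localForm_self_nonneg (hY J) (hS J)) (Finset.mem_univ J)

theorem BlocksPosDef.add (hY : BlocksPosDef Y) (hS : ∀ J, (S J).IsSymm)
    (h : blockForm Y S S < 1) : BlocksPosDef (Y + S) := fun J =>
  posDef_add (hY J) (hS J) ((localForm_le_blockForm hY hS J).trans_lt h)

theorem fFW_add_le (hY : BlocksPosDef Y) (hS : ∀ J, (S J).IsSymm) (h : blockForm Y S S ≤ 1 / 9) :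
    fFW (Y + S) ≤ fFW Y + gradFW Y S + blockForm Y S S := by
  rw [fFW_eq_sum, fFW_eq_sum, gradFW_apply, blockForm_apply, ← Finset.sum_add_distrib,
    ← Finset.sum_add_distrib]
  exact Finset.sum_le_sum fun J _ =>
    fSDP_add_le (hY J) (hS J) ((localForm_le_blockForm hY hS J).trans h)

theorem lineDeriv_fFW (hY : ∀ J, (Y J).det ≠ 0) (U : Blocks n k) :
    lineDeriv ℝ fFW Y U = gradFW Y U := by
  rw [gradFW_apply]
  refine HasDerivAt.deriv ?_
  simp only [fFW_eq_sum]
  exact HasDerivAt.fun_sum fun J _ => hasDerivAt_fSDP (hY J) (U J)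

theorem hess_fFW (hY : ∀ J, (Y J).det ≠ 0) (U W : Blocks n k) :
    hess fFW Y U W = blockForm Y U W := by
  have heq : (fun t : ℝ => lineDeriv ℝ fFW (Y + t • U) W) =ᶠ[nhds 0]
      fun t => ∑ J, gradSDP (Y J + t • U J) (W J) := by
    filter_upwards [Filter.eventually_all.2 fun J =>
      eventually_det_add_smul_ne_zero (hY J) (U J)] with t ht
    exact (lineDeriv_fFW ht W).trans (gradFW_apply _ _)
  rw [blockForm_apply]
  exact heq.deriv_eq.trans
    (HasDerivAt.fun_sum fun J _ => hasDerivAt_gradSDP (hY J) (U J) (W J)).deriv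

end BlockBarrier

section Instances

variable {n k : ℕ}

theorem hasPosDefHessian_fSDP {L : AffineSubspace ℝ (Mat n)} {X : Mat n} (hX : X.PosDef)
    (hL : ∀ d ∈ L.direction, d.IsSymm) :
    HasPosDefHessian fSDP L X (gradSDP X) (localForm X) where
  lineDeriv_eq := lineDeriv_fSDP hX.det_pos.ne'
  hess_eq := hess_fSDP hX.det_pos.ne'
  isSymm := localForm_isSymm X
  pos d hd hd0 := (localForm_self_nonneg hX (hL d hd)).lt_of_ne'
    fun h => hd0 ((localForm_self_eq_zero_iff hX (hL d hd)).1 h)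

theorem hasPosDefHessian_fFW {L : AffineSubspace ℝ (Blocks n k)} {Y : Blocks n k}
    (hY : BlocksPosDef Y) (hL : ∀ d ∈ L.direction, ∀ J, (d J).IsSymm) :
    HasPosDefHessian fFW L Y (gradFW Y) (blockForm Y) where
  lineDeriv_eq := lineDeriv_fFW fun J => (hY J).det_pos.ne'
  hess_eq := hess_fFW fun J => (hY J).det_pos.ne'
  isSymm := ⟨fun U W => by
    simp only [blockForm_apply]
    exact Finset.sum_congr rfl fun J _ => (localForm_isSymm (Y J)).eq (U J) (W J)⟩
  pos d hd hd0 := by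
    obtain ⟨J, hJ⟩ := Function.ne_iff.1 hd0
    exact ((localForm_self_nonneg (hY J) (hL d hd J)).lt_of_ne'
      fun h => hJ ((localForm_self_eq_zero_iff (hY J) (hL d hd J)).1 h)).trans_le
      (localForm_le_blockForm hY (hL d hd) J)

end Instances

section Averaging

open MulAction

theorem card_smul_sum_smul_eq {G α M : Type*} [Group G] [Fintype G] [Fintype α] [MulAction G α]
    [IsPretransitive G α] [AddCommMonoid M] (x : α) (F : α → M) :
    Fintype.card α • ∑ g : G, F (g • x) = Fintype.card G • ∑ y, F y := by
  have hconst (y : α) : ∑ g : G, F (g • y) = ∑ g : G, F (g • x) := by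
    obtain ⟨h, rfl⟩ := exists_smul_eq G x y
    simp only [smul_smul]
    exact Equiv.sum_comp (Equiv.mulRight h) fun g => F (g • x)
  calc Fintype.card α • ∑ g : G, F (g • x) = ∑ y, ∑ g : G, F (g • y) := by
        rw [Finset.sum_congr rfl fun y _ => hconst y, Finset.sum_const, Finset.card_univ]
    _ = ∑ g : G, ∑ y, F (g • y) := Finset.sum_comm
    _ = ∑ _g : G, ∑ y, F y :=
        Finset.sum_congr rfl fun g _ => Equiv.sum_comp (MulAction.toPerm g) F
    _ = Fintype.card G • ∑ y, F y := by rw [Finset.sum_const, Finset.card_univ]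

variable {n k : ℕ}

instance : MulAction (Equiv.Perm (Fin n)) (Idx n k) :=
  inferInstanceAs (MulAction _ (Set.powersetCard (Fin n) k))

instance : IsPretransitive (Equiv.Perm (Fin n)) (Idx n k) :=
  Set.powersetCard.isPretransitive

/-- The blocks `P a` are pairwise disjoint, so that they partition `{1, …, n}` when there are
`n / k` of them. -/
def IsPartition {ι : Type*} (P : ι → Idx n k) : Prop :=
  Pairwise fun a b => Disjoint (P a).1 (P b).1

variable {ι : Type*} {P : ι → Idx n k}

theorem IsPartition.smul (hP : IsPartition P) (g : Equiv.Perm (Fin n)) :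
    IsPartition fun a => g • P a := fun _ _ hab =>
  (Finset.disjoint_image (MulAction.injective g)).2 (hP hab)

theorem exists_isPartition {r : ℕ} (hn : k * r = n) : ∃ P : Fin r → Idx n k, IsPartition P := by
  subst hn
  let row (a : Fin r) : Fin k ↪ Fin (k * r) :=
    ⟨fun p => finProdFinEquiv (p, a), fun p q h => by simpa using h⟩
  refine ⟨fun a => ⟨Finset.univ.map (row a), by simp⟩, fun a b hab => ?_⟩
  simp only [Finset.disjoint_left, Finset.mem_map, Finset.mem_univ, true_and]
  rintro _ ⟨p, rfl⟩ ⟨q, hq⟩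
  exact hab (Prod.ext_iff.1 (finProdFinEquiv.injective hq)).2.symm

theorem choose_eq_mul {r : ℕ} (hn : k * r = n) (hk : 0 < k) :
    n.choose k = r * (n - 1).choose (k - 1) := by
  refine Nat.eq_of_mul_eq_mul_right hk ?_
  obtain rfl | hr := r.eq_zero_or_pos
  · obtain rfl : n = 0 := by simpa using hn.symm
    simp [Nat.choose_eq_zero_of_lt hk]
  · have hn0 : 0 < n := hn ▸ Nat.mul_pos hk hr
    have h := Nat.add_one_mul_choose_eq (n - 1) (k - 1)
    rw [Nat.sub_add_cancel hn0, Nat.sub_add_cancel hk, ← hn] at h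
    rw [← hn, ← h]
    ring

theorem card_Idx : Fintype.card (Idx n k) = n.choose k := by simp

theorem choose_smul_sum_perm_smul_eq {r : ℕ} {M : Type*} [AddCommGroup M] [Module ℝ M]
    (hn : k * r = n) (hk : 0 < k) (hr : 0 < r) (P : Fin r → Idx n k) (F : Idx n k → M) :
    ((n - 1).choose (k - 1) : ℝ) • ∑ g : Equiv.Perm (Fin n), ∑ a, F (g • P a) =
      (n.factorial : ℝ) • ∑ J, F J := by
  have hr0 : (r : ℝ) ≠ 0 := by exact_mod_cast hr.ne'
  have hsum (a : Fin r) : (r : ℝ) • ((n - 1).choose (k - 1) : ℝ) •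
      ∑ g : Equiv.Perm (Fin n), F (g • P a) = (n.factorial : ℝ) • ∑ J, F J := by
    simpa only [card_Idx, choose_eq_mul hn hk, Fintype.card_perm, Fintype.card_fin,
      ← Nat.cast_smul_eq_nsmul ℝ, Nat.cast_mul, mul_smul] using
      card_smul_sum_smul_eq (G := Equiv.Perm (Fin n)) (P a) F
  refine smul_right_injective M hr0 ?_
  change (r : ℝ) • _ = (r : ℝ) • _
  rw [Finset.sum_comm, Finset.smul_sum, Finset.smul_sum, Finset.sum_congr rfl fun a _ => hsum a,
    Finset.sum_const, Finset.card_univ, Fintype.card_fin, ← Nat.cast_smul_eq_nsmul ℝ]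

variable [Fintype ι]

theorem submatrix_sum_embed_eq_blockDiagonal [DecidableEq ι] (hP : IsPartition P) (Y : Blocks n k) :
    (∑ a, embed (P a) (Y (P a))).submatrix (fun x : Fin k × ι => emb (P x.2) x.1)
      (fun x => emb (P x.2) x.1) = blockDiagonal fun a => Y (P a) := by
  ext ⟨p, a⟩ ⟨q, b⟩
  have hnot {a c : ι} (p : Fin k) (hca : c ≠ a) : emb (P a) p ∉ (P c).1 := fun h =>
    Finset.disjoint_left.1 (hP hca) h (emb_mem _ p)
  rw [submatrix_apply, Matrix.sum_apply, Finset.sum_eq_single a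
    (fun c _ hc => embed_apply_of_not_subset (fun h => hnot p hc (h (by simp))) _) (by simp)]
  obtain rfl | hab := eq_or_ne a b
  · rw [embed_apply_emb, blockDiagonal_apply_eq]
  · rw [blockDiagonal_apply_ne _ _ _ hab,
      embed_apply_of_not_subset fun h => hnot q hab (h (by simp))]

theorem det_sum_embed (hcard : k * Fintype.card ι = n) (hP : IsPartition P) (Y : Blocks n k) :
    (∑ a, embed (P a) (Y (P a))).det = ∏ a, (Y (P a)).det := by
  classical
  have hinj : Function.Injective fun x : Fin k × ι => emb (P x.2) x.1 := by
    rintro ⟨p, a⟩ ⟨q, b⟩ (h : emb (P a) p = emb (P b) q)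
    obtain rfl | hab := eq_or_ne a b
    · rw [(emb (P a)).injective h]
    · exact (Finset.disjoint_left.1 (hP hab) (emb_mem _ p) (h ▸ emb_mem _ q)).elim
  have hbij := (Fintype.bijective_iff_injective_and_card _).2 ⟨hinj, by simp [hcard]⟩
  rw [← det_submatrix_equiv_self (Equiv.ofBijective _ hbij), ← det_blockDiagonal,
    ← submatrix_sum_embed_eq_blockDiagonal hP]
  rfl

theorem sum_embed_posDef (hcard : k * Fintype.card ι = n) (hP : IsPartition P) {Y : Blocks n k}
    (hY : BlocksPosDef Y) : (∑ a, embed (P a) (Y (P a))).PosDef := by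
  have hpsd : (∑ a, embed (P a) (Y (P a))).PosSemidef := posSemidef_sum _ fun a _ => by
    rw [embed_eq]
    exact (hY _).posSemidef.conjTranspose_mul_mul_same _
  rw [hpsd.posDef_iff_det_ne_zero, det_sum_embed hcard hP]
  exact Finset.prod_ne_zero_iff.2 fun a _ => (hY _).det_pos.ne'

theorem fSDP_sum_embed (hcard : k * Fintype.card ι = n) (hP : IsPartition P) {Y : Blocks n k}
    (hY : BlocksPosDef Y) :
    fSDP (∑ a, embed (P a) (Y (P a))) = ∑ a, fSDP (Y (P a)) := by
  simp only [fSDP, det_sum_embed hcard hP, Real.log_prod fun a _ => (hY (P a)).det_pos.ne',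
    Finset.sum_neg_distrib]

theorem fSDP_smul {c : ℝ} (hc : 0 < c) {X : Mat n} (hX : X.PosDef) :
    fSDP (c • X) = fSDP X - n * Real.log c := by
  rw [fSDP, det_smul, Real.log_mul (by positivity) hX.det_pos.ne', Real.log_pow, Fintype.card_fin,
    fSDP]
  ring

theorem fFW_Y0 {r : ℕ} (hn : k * r = n) (hk : 0 < k) (hkn : k ≤ n) :
    fFW (Y0 n k) = ((n - 1).choose (k - 1) : ℝ) * (n * Real.log ((n - 1).choose (k - 1))) := by
  have hblock (J : Idx n k) : fSDP (Y0 n k J) = k * Real.log ((n - 1).choose (k - 1)) := by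
    rw [Y0, fSDP_smul (one_div_pos.2 (choose_pos_cast hkn)) PosDef.one, fSDP, det_one,
      Real.log_one, one_div, Real.log_inv]
    ring
  simp only [fFW_eq_sum, hblock, Finset.sum_const, Finset.card_univ, card_Idx, nsmul_eq_mul,
    choose_eq_mul hn hk]
  rw [← hn]
  push_cast
  ring

/-- Averaging Fenchel's inequality between `Q` and the block-diagonal matrices assembled from `Y`
along all translates of a partition. -/
theorem choose_mul_le_ip_Psi_add {r : ℕ} (hn : k * r = n) (hk : 0 < k) (hr : 0 < r)
    {Y : Blocks n k} (hY : BlocksPosDef Y) {Q : Mat n} (hQ : Q.PosDef) :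
    ((n - 1).choose (k - 1) : ℝ) * n ≤
      ip Q (Psi Y) + ((n - 1).choose (k - 1) : ℝ) * fSDP Q + fFW Y := by
  set C : ℝ := ((n - 1).choose (k - 1) : ℝ)
  obtain ⟨P, hP⟩ := exists_isPartition hn
  have hcard : k * Fintype.card (Fin r) = n := by rwa [Fintype.card_fin]
  have hfenchel (g : Equiv.Perm (Fin n)) :
      n ≤ ip Q (∑ a, embed (g • P a) (Y (g • P a))) + fSDP Q + ∑ a, fSDP (Y (g • P a)) := by
    rw [← fSDP_sum_embed hcard (hP.smul g) hY]
    exact natCast_le_ip_add_fSDP_add_fSDP hQ (sum_embed_posDef hcard (hP.smul g) hY)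
  have hsum := mul_le_mul_of_nonneg_left
    (Finset.sum_le_sum fun g (_ : g ∈ Finset.univ) => hfenchel g) (Nat.cast_nonneg _ : 0 ≤ C)
  have hip := choose_smul_sum_perm_smul_eq hn hk hr P fun J => ip Q (embed J (Y J))
  have hfFW := choose_smul_sum_perm_smul_eq hn hk hr P fun J => fSDP (Y J)
  rw [← fFW_eq_sum] at hfFW
  rw [← ip_sum, ← Psi] at hip
  simp only [Finset.sum_add_distrib, ip_sum, Finset.sum_const, Finset.card_univ,
    Fintype.card_perm, Fintype.card_fin, nsmul_eq_mul, mul_add, smul_eq_mul] at hsum hip hfFW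
  rw [hip, hfFW] at hsum
  have hfact : (0 : ℝ) < n.factorial := by exact_mod_cast n.factorial_pos
  refine le_of_mul_le_mul_left ?_ hfact
  linarith

theorem choose_mul_fSDP_Psi_le (hk : 0 < k) (hkn : k ∣ n) (hn : 0 < n) {Y : Blocks n k}
    (hY : BlocksPosDef Y) :
    ((n - 1).choose (k - 1) : ℝ) * fSDP (Psi Y) ≤ fFW Y - fFW (Y0 n k) := by
  obtain ⟨r, hr⟩ := hkn
  have hle := Nat.le_of_dvd hn ⟨r, hr⟩
  have hC := choose_pos_cast hle
  have hX := Psi_posDef hk hle hY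
  have h := choose_mul_le_ip_Psi_add hr.symm hk (Nat.pos_of_mul_pos_left (hr ▸ hn)) hY
    (hX.inv.smul hC)
  rw [fSDP_smul hC hX.inv, fSDP_inv hX, ip_comm, ip_smul, ip_comm, ip,
    nonsing_inv_mul _ ((isUnit_iff_isUnit_det _).1 hX.isUnit), trace_one, Fintype.card_fin] at h
  rw [fFW_Y0 hr.symm hk hle]
  linarith

end Averaging

section Slices

variable {n k m : ℕ} {A₀ : Mat n} {A : Fin m → Mat n} {b : Fin m → ℝ} {v : ℝ} {X S : Mat n}

theorem mem_slice :
    X ∈ slice A₀ A b v ↔ X.IsSymm ∧ ip A₀ X = v ∧ ∀ i, ip (A i) X = b i := Iff.rfl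

theorem mem_slice_direction (hX : X ∈ slice A₀ A b v) {d : Mat n} :
    d ∈ (slice A₀ A b v).direction ↔ d.IsSymm ∧ ip A₀ d = 0 ∧ ∀ i, ip (A i) d = 0 := by
  rw [← AffineSubspace.vadd_mem_iff_mem_direction d hX, vadd_eq_add, mem_slice, ip_add, hX.2.1]
  simp only [ip_add, hX.2.2, add_eq_right]
  exact and_congr_left fun _ =>
    ⟨fun h => by simpa only [add_sub_cancel_right] using h.sub hX.1, fun h => h.add hX.1⟩

theorem mem_sliceAt : S ∈ sliceAt A₀ A b v X ↔
    S.IsSymm ∧ ip A₀ (rescale X S) = v ∧ ∀ i, ip (A i) (rescale X S) = b i := by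
  simp only [ip_rescale]
  exact Iff.rfl

theorem mem_blockSliceAt {Y : Blocks n k} : Y ∈ blockSliceAt k A₀ A b v X ↔
    (∀ J, (Y J).IsSymm) ∧ ip A₀ (rescale X (Psi Y)) = v ∧
      ∀ i, ip (A i) (rescale X (Psi Y)) = b i := by
  simp only [ip_rescale]
  exact Iff.rfl

theorem mem_blockSliceAt_direction {Y : Blocks n k} (hY : Y ∈ blockSliceAt k A₀ A b v X)
    {d : Blocks n k} : d ∈ (blockSliceAt k A₀ A b v X).direction ↔ (∀ J, (d J).IsSymm) ∧
      ip A₀ (rescale X (Psi d)) = 0 ∧ ∀ i, ip (A i) (rescale X (Psi d)) = 0 := by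
  rw [← AffineSubspace.vadd_mem_iff_mem_direction d hY, vadd_eq_add, mem_blockSliceAt]
  rw [mem_blockSliceAt] at hY
  simp only [Psi_add, rescale_add, ip_add, hY.2.1, hY.2.2, add_eq_right]
  exact and_congr_left fun _ => forall_congr' fun J =>
    ⟨fun h => by simpa only [Pi.add_apply, add_sub_cancel_right] using h.sub (hY.1 J),
      fun h => h.add (hY.1 J)⟩

theorem StrictlyFeasible.isSymm (hX : StrictlyFeasible A b X) : X.IsSymm :=
  isHermitian_iff_isSymm.1 hX.1.1

theorem StrictlyFeasible.mem_slice (hX : StrictlyFeasible A b X) (hv : ip A₀ X = v) :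
    X ∈ slice A₀ A b v := ⟨hX.isSymm, hv, hX.2⟩

theorem StrictlyFeasible.one_mem_sliceAt (hX : StrictlyFeasible A b X) (hv : ip A₀ X = v) :
    1 ∈ sliceAt A₀ A b v X := by
  rw [mem_sliceAt, rescale_one hX.1]
  exact ⟨isSymm_one, hv, hX.2⟩

theorem StrictlyFeasible.Y0_mem_blockSliceAt (hX : StrictlyFeasible A b X) (hv : ip A₀ X = v)
    (hk : 2 ≤ k) (hkn : k ≤ n) : Y0 n k ∈ blockSliceAt k A₀ A b v X := by
  rw [mem_blockSliceAt, Psi_Y0 hk hkn, rescale_one hX.1]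
  exact ⟨(Y0_posDef hkn).isSymm, hv, hX.2⟩

end Slices

section PositiveSemidefinite

variable {n : ℕ} {P S X : Mat n}

theorem posSemidef_rescale_iff (hX : X.PosDef) : (rescale X S).PosSemidef ↔ S.PosSemidef := by
  have h := IsUnit.posSemidef_star_left_conjugate_iff (x := S) (isUnit_sqrt hX)
  rwa [star_eq_conjTranspose, (isHermitian_sqrt X).eq] at h

theorem ip_nonneg (hP : P.PosDef) (hS : S.PosSemidef) : 0 ≤ ip P S := by
  rw [← trace_rescale hP]
  exact ((posSemidef_rescale_iff hP).2 hS).trace_nonneg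

theorem isClosed_posSemidef {ι : Type*} [Finite ι] :
    IsClosed {S : Matrix ι ι ℝ | S.PosSemidef} := by
  cases nonempty_fintype ι
  simp only [posSemidef_iff_dotProduct_mulVec, Set.ofPred_and, Set.ofPred_forall, IsHermitian]
  exact (isClosed_eq (by fun_prop) (by fun_prop)).inter
    (isClosed_iInter fun x => isClosed_le continuous_const (by fun_prop))

theorem abs_apply_le_trace {ι : Type*} [Fintype ι] {S : Matrix ι ι ℝ} (hS : S.PosSemidef)
    (i j : ι) : |S i j| ≤ S.trace := by
  classical
  refine abs_le_of_sq_le_sq ?_ hS.trace_nonneg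
  calc S i j ^ 2 ≤ ∑ j, S i j ^ 2 :=
        Finset.single_le_sum (fun j _ => sq_nonneg (S i j)) (Finset.mem_univ j)
    _ ≤ ∑ i, ∑ j, S i j ^ 2 :=
        Finset.single_le_sum (f := fun i => ∑ j, S i j ^ 2) (fun i _ => by positivity)
          (Finset.mem_univ i)
    _ = ∑ i, hS.1.eigenvalues i ^ 2 := by
        rw [← trace_mul_self_eq_sum_sq hS.1, trace_mul_self_eq_sum_sq_eigenvalues hS.1]
    _ ≤ S.trace ^ 2 := by
        rw [hS.1.trace_eq_sum_eigenvalues]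
        exact Finset.sum_sq_le_sq_sum_of_nonneg fun i _ => hS.eigenvalues_nonneg i

theorem isCompact_posSemidef_trace_le {ι : Type*} [Fintype ι] (c : ℝ) :
    IsCompact {S : Matrix ι ι ℝ | S.PosSemidef ∧ S.trace ≤ c} := by
  classical
  have hbox : IsCompact (Set.univ.pi fun _ : ι => Set.univ.pi fun _ : ι => Set.Icc (-c) c) :=
    isCompact_univ_pi fun _ => isCompact_univ_pi fun _ => isCompact_Icc
  refine hbox.of_isClosed_subset
    (isClosed_posSemidef.inter (isClosed_le continuous_id.matrix_trace continuous_const)) ?_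
  rintro S ⟨hS, htrace⟩ i - j -
  exact abs_le.1 ((abs_apply_le_trace hS i j).trans htrace)

theorem isCompact_posSemidef_ip_le (hP : P.PosDef) (c : ℝ) :
    IsCompact {S : Mat n | S.PosSemidef ∧ ip P S ≤ c} := by
  have hcont : Continuous (rescale P⁻¹) := by
    unfold rescale
    fun_prop
  convert (isCompact_posSemidef_trace_le (ι := Fin n) c).image hcont using 1
  ext S
  constructor
  · rintro ⟨hS, hc⟩
    exact ⟨rescale P S, ⟨(posSemidef_rescale_iff hP).2 hS, (trace_rescale hP S).trans_le hc⟩,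
      rescale_inv_rescale hP S⟩
  · rintro ⟨T, ⟨hT, hc⟩, rfl⟩
    refine ⟨(posSemidef_rescale_iff hP.inv).2 hT, ?_⟩
    rwa [← trace_rescale hP, rescale_rescale_inv hP]

end PositiveSemidefinite

section NewtonGap

variable {n : ℕ} {X z : Mat n}

theorem ip_inv_self (hX : X.PosDef) : ip X⁻¹ X = n := by
  rw [ip, nonsing_inv_mul _ ((isUnit_iff_isUnit_det X).1 hX.isUnit), trace_one, Fintype.card_fin]

theorem fSDP_le_add_ip_inv (hz : z.PosDef) (hX : X.PosDef) :
    fSDP z ≤ fSDP X + ip z⁻¹ (X - z) := by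
  have h := natCast_le_ip_add_fSDP_add_fSDP hz.inv hX
  rw [fSDP_inv hz] at h
  rw [ip_sub, ip_inv_self hz]
  linarith

theorem posDef_inv_mul_mul_inv (hX : X.PosDef) (hz : z.PosDef) : (X⁻¹ * z * X⁻¹).PosDef := by
  have h := (IsUnit.posDef_star_left_conjugate_iff (x := z) hX.inv.isUnit).2 hz
  rwa [star_eq_conjTranspose, hX.inv.1.eq] at h

theorem fSDP_inv_mul_mul_inv (hX : X.PosDef) (hz : z.PosDef) :
    fSDP (X⁻¹ * z * X⁻¹) = fSDP z - 2 * fSDP X := by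
  rw [fSDP, det_mul, det_mul, Real.log_mul (mul_pos hX.inv.det_pos hz.det_pos).ne'
    hX.inv.det_pos.ne', Real.log_mul hX.inv.det_pos.ne' hz.det_pos.ne']
  have hinv := fSDP_inv hX
  rw [fSDP] at hinv
  rw [fSDP]
  linarith

/-- Fenchel's inequality for `z` and the dual point `X⁻¹ (X - s) X⁻¹`, where `s` is the Newton
step, for which `⟨X⁻¹ (X - s) X⁻¹, z⟩ = n - Δ²`. -/
theorem fSDP_sub_le_sq_newtonDecrement {L : AffineSubspace ℝ (Mat n)} (hX : X.PosDef)
    (hL : ∀ d ∈ L.direction, d.IsSymm) (hz : z.PosDef) (hzX : z - X ∈ L.direction)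
    (hΔ : newtonDecrement fSDP L X ≤ 1 / 3) :
    fSDP X - fSDP z ≤ newtonDecrement fSDP L X ^ 2 := by
  have hH := hasPosDefHessian_fSDP hX hL
  have hs := hL _ hH.newtonStep_mem
  have hstep := hH.apply_newtonStep hzX
  have hgrad := hH.apply_gradient_newtonStep
  have hself := hH.sq_newtonDecrement
  have hΔ0 := newtonDecrement_nonneg fSDP L X
  set s := newtonStep fSDP L X
  set Δ := newtonDecrement fSDP L X
  have hneg : localForm X (-s) (-s) = Δ ^ 2 := by simp [hself]
  have hΔsq : Δ ^ 2 ≤ 1 / 9 := by nlinarith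
  have hXs : (X + -s).PosDef := posDef_add hX hs.neg (by rw [hneg]; linarith)
  have hbarrier := fSDP_add_le hX hs.neg (hneg.trans_le hΔsq)
  have hfenchel := natCast_le_ip_add_fSDP_add_fSDP (posDef_inv_mul_mul_inv hX hXs) hz
  have hdet : IsUnit X.det := (isUnit_iff_isUnit_det X).1 hX.isUnit
  have hdual : ip (X⁻¹ * (X + -s) * X⁻¹) z = n - Δ ^ 2 := by
    have hsX : localForm X s X = Δ ^ 2 := by
      rw [localForm_apply, nonsing_inv_mul _ hdet, mul_one, ← neg_neg (trace _), ← neg_neg (Δ ^ 2)]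
      exact congrArg _ hgrad
    have hsz : ip (X⁻¹ * s * X⁻¹) z = localForm X s z := by
      rw [ip, localForm_apply, mul_assoc _ _ z]
    rw [mul_add, add_mul, nonsing_inv_mul _ hdet, one_mul, ip_comm, ip_add, mul_neg, neg_mul,
      ← neg_one_smul ℝ, ip_smul, ip_comm z, ip_comm z, hsz]
    rw [map_sub, map_sub, hsX, gradSDP_apply, gradSDP_apply, ip_inv_self hX] at hstep
    linarith
  rw [hdual, fSDP_inv_mul_mul_inv hX hXs] at hfenchel
  rw [hneg, map_neg, hgrad] at hbarrier
  linarith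

end NewtonGap

section CentralPath

open Filter Topology

variable {n m : ℕ} {A₀ : Mat n} {A : Fin m → Mat n} {b : Fin m → ℝ} {η : ℝ} {X z d : Mat n}

theorem StrictlyFeasible.add_smul (hz : StrictlyFeasible A b z) (hd : ∀ i, ip (A i) d = 0) {t : ℝ}
    (ht : (z + t • d).PosDef) : StrictlyFeasible A b (z + t • d) :=
  ⟨ht, fun i => by rw [ip_add, ip_smul, hd, mul_zero, add_zero, hz.2]⟩

theorem eventually_posDef_add_smul (hX : X.PosDef) (hd : d.IsSymm) :
    ∀ᶠ t : ℝ in 𝓝 0, (X + t • d).PosDef := by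
  have hcont : ContinuousAt (fun t : ℝ => t * (t * localForm X d d)) 0 := by fun_prop
  filter_upwards [hcont.eventually_lt_const (show _ < (1 : ℝ) by norm_num)] with t ht
  exact posDef_add hX (hd.smul t) (by simpa using ht)

theorem ip_inv_eq_of_forall_le (hz : z.PosDef) (hd : d.IsSymm) (c : ℝ)
    (hmin : ∀ t : ℝ, (z + t • d).PosDef →
      c * ip A₀ z + fSDP z ≤ c * ip A₀ (z + t • d) + fSDP (z + t • d)) :
    ip z⁻¹ d = c * ip A₀ d := by
  have hderiv : HasDerivAt (fun t : ℝ => c * ip A₀ (z + t • d) + fSDP (z + t • d))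
      (c * ip A₀ d + gradSDP z d) 0 := by
    refine HasDerivAt.fun_add ?_ (hasDerivAt_fSDP hz.det_pos.ne' d)
    simp only [ip_add, ip_smul]
    simpa using (((hasDerivAt_id (0 : ℝ)).mul_const (ip A₀ d)).const_add (ip A₀ z)).const_mul c
  have hlocal : IsLocalMin (fun t : ℝ => c * ip A₀ (z + t • d) + fSDP (z + t • d)) 0 := by
    filter_upwards [eventually_posDef_add_smul hz hd] with t ht
    simpa only [zero_smul, add_zero] using hmin t ht
  have hzero := hlocal.hasDerivAt_eq_zero hderiv
  rw [gradSDP_apply] at hzero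
  linarith

theorem isCentralPoint_of_ip_inv_eq (hη : 0 < η) (hz : StrictlyFeasible A b z)
    (hgrad : ∀ d : Mat n, d.IsSymm → (∀ i, ip (A i) d = 0) → ip z⁻¹ d = η * ip A₀ d) :
    IsCentralPoint A₀ A b η z := by
  refine ⟨hη, hz, fun X hX => ?_⟩
  have h := fSDP_le_add_ip_inv hz.1 hX.1
  rw [hgrad _ (hX.isSymm.sub hz.isSymm) fun i => by rw [ip_sub, hX.2, hz.2, sub_self],
    ip_sub] at h
  linarith

namespace IsCentralPoint

theorem ip_inv_eq (h : IsCentralPoint A₀ A b η z) (hd : d.IsSymm) (hd' : ∀ i, ip (A i) d = 0) :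
    ip z⁻¹ d = η * ip A₀ d :=
  ip_inv_eq_of_forall_le h.2.1.1 hd η fun _ ht => h.2.2 _ (h.2.1.add_smul hd' ht)

theorem ip_inv_eq_add (h : IsCentralPoint A₀ A b η z) (hX : X.IsSymm)
    (hX' : ∀ i, ip (A i) X = b i) : ip z⁻¹ X = n + η * (ip A₀ X - ip A₀ z) := by
  have hsub := h.ip_inv_eq (hX.sub h.2.1.isSymm) fun i => by rw [ip_sub, hX', h.2.1.2, sub_self]
  rw [ip_sub, ip_sub, ip_inv_self h.2.1.1] at hsub
  linarith

theorem fSDP_le (h : IsCentralPoint A₀ A b η z) (hX : StrictlyFeasible A b X)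
    (hv : ip A₀ X ≤ ip A₀ z) : fSDP z ≤ fSDP X := by
  have hmin := h.2.2 X hX
  have hobj := mul_le_mul_of_nonneg_left hv h.1.le
  linarith

theorem isCompact_feasible (h : IsCentralPoint A₀ A b η z) (v : ℝ) :
    IsCompact {S : Mat n | S.PosSemidef ∧ ip A₀ S = v ∧ ∀ i, ip (A i) S = b i} := by
  refine (isCompact_posSemidef_ip_le h.2.1.1.inv (n + η * (v - ip A₀ z))).of_isClosed_subset ?_ ?_
  · simp only [Set.ofPred_and, Set.ofPred_forall]
    exact isClosed_posSemidef.inter ((isClosed_eq (continuous_ip _) continuous_const).inter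
      (isClosed_iInter fun i => isClosed_eq (continuous_ip _) continuous_const))
  · rintro S ⟨hS, hSv, hSA⟩
    exact ⟨hS, by rw [h.ip_inv_eq_add (isHermitian_iff_isSymm.1 hS.1) hSA, hSv]⟩

theorem exists_forall_fSDP_le (h : IsCentralPoint A₀ A b η z) (hX : StrictlyFeasible A b X) :
    ∃ w, StrictlyFeasible A b w ∧ ip A₀ w = ip A₀ X ∧
      ∀ S, StrictlyFeasible A b S → ip A₀ S = ip A₀ X → fSDP w ≤ fSDP S := by
  obtain ⟨w, ⟨hw, hwv, hwA⟩, hmax⟩ := (h.isCompact_feasible (ip A₀ X)).exists_isMaxOn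
    ⟨X, hX.1.posSemidef, rfl, hX.2⟩ continuous_id.matrix_det.continuousOn
  have hdet : ∀ S, StrictlyFeasible A b S → ip A₀ S = ip A₀ X → S.det ≤ w.det := fun S hS hSv =>
    hmax ⟨hS.1.posSemidef, hSv, hS.2⟩
  have hwdet := hX.1.det_pos.trans_le (hdet X hX rfl)
  exact ⟨w, ⟨hw.posDef_iff_det_ne_zero.2 hwdet.ne', hwA⟩, hwv, fun S hS hSv =>
    neg_le_neg (Real.log_le_log hS.1.det_pos (hdet S hS hSv))⟩

end IsCentralPoint

/-- The quotient is the Lagrange multiplier of the constraint on the objective value. -/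
theorem StrictlyFeasible.ip_inv_eq_div_mul {w : Mat n} (hz : StrictlyFeasible A b z)
    (hmin : ∀ S, StrictlyFeasible A b S → ip A₀ S = ip A₀ z → fSDP z ≤ fSDP S)
    (hw : w.IsSymm) (hwA : ∀ i, ip (A i) w = 0) (hw₀ : ip A₀ w ≠ 0)
    (hd : d.IsSymm) (hdA : ∀ i, ip (A i) d = 0) :
    ip z⁻¹ d = ip z⁻¹ w / ip A₀ w * ip A₀ d := by
  set e := d - (ip A₀ d / ip A₀ w) • w with he
  have he₀ : ip A₀ e = 0 := by rw [he, ip_sub, ip_smul, div_mul_cancel₀ _ hw₀, sub_self]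
  have heA : ∀ i, ip (A i) e = 0 := fun i => by
    rw [he, ip_sub, ip_smul, hdA, hwA, mul_zero, sub_zero]
  have hcrit := ip_inv_eq_of_forall_le (A₀ := A₀) hz.1 (hd.sub (hw.smul _)) 0 fun t ht => by
    rw [zero_mul, zero_mul, zero_add, zero_add]
    exact hmin _ (hz.add_smul heA ht) (by rw [ip_add, ip_smul, he₀, mul_zero, add_zero])
  rw [zero_mul, ip_sub, ip_smul, sub_eq_zero] at hcrit
  rw [hcrit]
  ring

theorem IsCentralPoint.exists_isCentralPoint_of_ip_le (h : IsCentralPoint A₀ A b η z)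
    (hX : StrictlyFeasible A b X) (hv : ip A₀ X ≤ ip A₀ z) :
    ∃ η' z', IsCentralPoint A₀ A b η' z' ∧ ip A₀ z' = ip A₀ X := by
  rcases hv.eq_or_lt with hv | hv
  · exact ⟨η, z, h, hv.symm⟩
  obtain ⟨w, hw, hwX, hwmin⟩ := h.exists_forall_fSDP_le hX
  have hgap : 0 < ip A₀ (z - w) := by
    rw [ip_sub, hwX]
    exact sub_pos.2 hv
  have hmultiplier : 0 < ip w⁻¹ (z - w) := by
    have htangent := fSDP_le_add_ip_inv hw.1 h.2.1.1
    have hcentral := h.2.2 w hw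
    have hη := mul_pos h.1 hgap
    rw [ip_sub] at hη
    linarith
  refine ⟨_, w, isCentralPoint_of_ip_inv_eq (div_pos hmultiplier hgap) hw fun d hd hdA =>
    hw.ip_inv_eq_div_mul (fun S hS hSw => hwmin S hS (hSw.trans hwX))
      (h.2.1.isSymm.sub hw.isSymm) (fun i => ?_) hgap.ne' hd hdA, hwX⟩
  rw [ip_sub, h.2.1.2, hw.2, sub_self]

end CentralPath

section Predictor

variable {n k m : ℕ} {A₀ : Mat n} {A : Fin m → Mat n} {b : Fin m → ℝ} {X X' D : Mat n} {σ s : ℝ}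

theorem fSDP_add_le_of_posSemidef {S : Mat n} (hX : X.PosDef) (hS : S.PosSemidef) :
    fSDP (X + S) ≤ fSDP X := by
  have hXS := hX.add_posSemidef hS
  have htangent := fSDP_le_add_ip_inv hXS hX
  rw [sub_add_cancel_left, ← neg_one_smul ℝ, ip_smul] at htangent
  linarith [ip_nonneg hXS.inv hS]

theorem add_mul_smul_eq {E : Type*} [AddCommGroup E] [Module ℝ E] (x d : E) (σ s : ℝ) :
    x + (σ * s) • d = (1 - σ) • x + σ • (x + s • d) := by
  module

theorem posDef_add_mul_smul (hX : X.PosDef) (hD : (X + s • D).PosSemidef) (hσ0 : 0 ≤ σ)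
    (hσ1 : σ < 1) : (X + (σ * s) • D).PosDef := by
  rw [add_mul_smul_eq]
  exact (hX.smul (sub_pos.2 hσ1)).add_posSemidef (hD.smul hσ0)

theorem fSDP_add_mul_smul_le (hX : X.PosDef) (hD : (X + s • D).PosSemidef) (hσ0 : 0 ≤ σ)
    (hσ1 : σ < 1) : fSDP (X + (σ * s) • D) ≤ fSDP X + n * Real.log (1 / (1 - σ)) := by
  have hσ := sub_pos.2 hσ1
  calc fSDP (X + (σ * s) • D) ≤ fSDP ((1 - σ) • X) := by
        rw [add_mul_smul_eq]
        exact fSDP_add_le_of_posSemidef (hX.smul hσ) (hD.smul hσ0)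
    _ = fSDP X + n * Real.log (1 / (1 - σ)) := by
        rw [fSDP_smul hσ hX, one_div, Real.log_inv, mul_neg, sub_eq_add_neg]

theorem blocksPosSemidef_add_sSup_smul {Y Z : Blocks n k} (hY : BlocksPosSemidef Y)
    (hZ : Z = 0 ∨ BddAbove {s : ℝ | BlocksPosSemidef (Y + s • Z)}) :
    BlocksPosSemidef (Y + sSup {s : ℝ | BlocksPosSemidef (Y + s • Z)} • Z) ∧
      0 ≤ sSup {s : ℝ | BlocksPosSemidef (Y + s • Z)} := by
  obtain rfl | hbdd := hZ
  · simp [hY]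
  · have hclosed : IsClosed {s : ℝ | BlocksPosSemidef (Y + s • Z)} := by
      simp only [BlocksPosSemidef, Set.ofPred_forall]
      exact isClosed_iInter fun J => isClosed_posSemidef.preimage (by fun_prop)
    have hzero : (0 : ℝ) ∈ {s : ℝ | BlocksPosSemidef (Y + s • Z)} := by simpa using hY
    exact ⟨hclosed.csSup_mem ⟨0, hzero⟩ hbdd, le_csSup hbdd hzero⟩

theorem IsCentralPoint.bddAbove_posSemidef_add_smul {η : ℝ} {z : Mat n}
    (hz : IsCentralPoint A₀ A b η z) (hD : D.IsSymm) (hDA : ∀ i, ip (A i) D = 0)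
    (hD₀ : ip A₀ D < 0) (X : Mat n) : BddAbove {s : ℝ | (X + s • D).PosSemidef} := by
  refine ⟨ip z⁻¹ X / (η * -ip A₀ D), fun s hs => ?_⟩
  have hnonneg := ip_nonneg hz.2.1.1.inv hs
  rw [ip_add, ip_smul, hz.ip_inv_eq hD hDA] at hnonneg
  rw [le_div_iff₀ (mul_pos hz.1 (neg_pos.2 hD₀))]
  linarith

theorem ip_sum_smul_sub_eq_neg (y : Fin m → ℝ)
    (hy : ∀ i, ip (A i) (∑ j, y j • A j - A₀) = 0) :
    ip A₀ (∑ j, y j • A j - A₀) = -ip (∑ j, y j • A j - A₀) (∑ j, y j • A j - A₀) := by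
  set W := ∑ j, y j • A j - A₀ with hW
  have hsum : ip W (∑ j, y j • A j) = 0 := by
    rw [ip_sum]
    exact Finset.sum_eq_zero fun j _ => by rw [ip_smul, ip_comm, hy, mul_zero]
  rw [← neg_eq_iff_eq_neg, ip_comm, ← zero_sub, ← hsum, ← ip_sub, ← hW]

theorem rescale_Psi_Y0_add_smul_PsiDagger (hk : 2 ≤ k) (hkn : k ≤ n) (hX : X.PosDef) (W : Mat n)
    (s : ℝ) : rescale X (Psi (Y0 n k + s • PsiDagger W)) = X + s • rescale X W := by
  rw [Psi_add, Psi_smul, Psi_Y0 hk hkn, Psi_PsiDagger hk hkn, rescale_add, rescale_one hX,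
    rescale_smul]

theorem IsPredictorStep.exists_eq_add_mul_smul (hpred : IsPredictorStep k A₀ A σ X X')
    (hk : 2 ≤ k) (hkn : k ≤ n) (hA₀ : A₀.IsSymm) (hA : ∀ i, (A i).IsSymm)
    (hcentral : ∃ η z, IsCentralPoint A₀ A b η z) (hX : X.PosDef) :
    ∃ D s, (∀ i, ip (A i) D = 0) ∧ ip A₀ D ≤ 0 ∧ 0 ≤ s ∧ (X + s • D).PosSemidef ∧
      X' = X + (σ * s) • D := by
  obtain ⟨η, z, hz⟩ := hcentral
  obtain ⟨y, hy, hX'⟩ := hpred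
  set W := ∑ j, y j • rescale X (A j) - rescale X A₀
  have hpath := rescale_Psi_Y0_add_smul_PsiDagger hk hkn hX W
  replace hX' := Eq.trans hX' (hpath _)
  have hWsymm : W.IsSymm := by
    refine IsSymm.sub ?_ (isSymm_rescale X hA₀)
    rw [IsSymm, transpose_sum]
    exact Finset.sum_congr rfl fun j _ => ((isSymm_rescale X (hA j)).smul (y j)).eq
  have hWherm := isHermitian_iff_isSymm.2 hWsymm
  have hWA (i) : ip (rescale X (A i)) W = 0 := by rw [ip_sub, hy, sub_self]
  have hWA₀ : ip A₀ (rescale X W) = -ip W W := by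
    rw [ip_rescale]
    exact ip_sum_smul_sub_eq_neg y hWA
  have hDA (i) : ip (A i) (rescale X W) = 0 := by rw [ip_rescale, hWA]
  have hbdd : (PsiDagger W : Blocks n k) = 0 ∨
      BddAbove {s : ℝ | BlocksPosSemidef (Y0 n k + s • PsiDagger W)} := by
    obtain hW | hW := eq_or_ne W 0
    · exact .inl (by ext; simp [hW, PsiDagger])
    · have hpos : 0 < ip W W := (trace_mul_self_nonneg hWherm).lt_of_ne'
        ((trace_mul_self_eq_zero_iff hWherm).not.2 hW)
      refine .inr ((hz.bddAbove_posSemidef_add_smul (isSymm_rescale X hWsymm) hDA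
        (by linarith) X).mono fun s hs => ?_)
      rw [Set.mem_ofPred_eq, ← hpath]
      exact (posSemidef_rescale_iff hX).2 (Psi_posSemidef hs)
  obtain ⟨hpsd, hnonneg⟩ :=
    blocksPosSemidef_add_sSup_smul (fun J => (Y0_posDef hkn J).posSemidef) hbdd
  refine ⟨rescale X W, _, hDA, ?_, hnonneg, ?_, hX'⟩
  · rw [hWA₀]
    exact neg_nonpos.2 (trace_mul_self_nonneg hWherm)
  · rw [← hpath]
    exact (posSemidef_rescale_iff hX).2 (Psi_posSemidef hpsd)

theorem IsPredictorStep.strictlyFeasible_and_le (hpred : IsPredictorStep k A₀ A σ X X')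
    (hk : 2 ≤ k) (hkn : k ≤ n) (hA₀ : A₀.IsSymm) (hA : ∀ i, (A i).IsSymm) (hσ0 : 0 ≤ σ)
    (hσ1 : σ < 1) (hcentral : ∃ η z, IsCentralPoint A₀ A b η z) (hX : StrictlyFeasible A b X) :
    StrictlyFeasible A b X' ∧ ip A₀ X' ≤ ip A₀ X ∧
      fSDP X' ≤ fSDP X + n * Real.log (1 / (1 - σ)) := by
  obtain ⟨D, s, hDA, hD₀, hs, hpsd, rfl⟩ :=
    hpred.exists_eq_add_mul_smul hk hkn hA₀ hA hcentral hX.1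
  refine ⟨hX.add_smul hDA (posDef_add_mul_smul hX.1 hpsd hσ0 hσ1), ?_,
    fSDP_add_mul_smul_le hX.1 hpsd hσ0 hσ1⟩
  rw [ip_add, ip_smul]
  exact add_le_of_nonpos_right (mul_nonpos_of_nonneg_of_nonpos (mul_nonneg hσ0 hs) hD₀)

end Predictor

section LineSearch

variable {n k : ℕ} {L : AffineSubspace ℝ (Blocks n k)} {Y : Blocks n k}

/-- The step length `1 / (3 (1 + Δ))` keeps the local norm of the step below `1 / 3`, the range in
which the quadratic upper bound for the barrier holds. -/
theorem exists_fFW_add_smul_newtonStep_le (hY : BlocksPosDef Y)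
    (hL : ∀ d ∈ L.direction, ∀ J, (d J).IsSymm) :
    ∃ t : ℝ, BlocksPosDef (Y + t • newtonStep fFW L Y) ∧
      fFW (Y + t • newtonStep fFW L Y) ≤ fFW Y - newtonDecrement fFW L Y ^ 2 *
        (2 + 3 * newtonDecrement fFW L Y) / (9 * (1 + newtonDecrement fFW L Y) ^ 2) := by
  have hH := hasPosDefHessian_fFW hY hL
  have hgrad := hH.apply_gradient_newtonStep
  have hself := hH.sq_newtonDecrement
  have hΔ := newtonDecrement_nonneg fFW L Y
  set s := newtonStep fFW L Y
  set Δ := newtonDecrement fFW L Y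
  set t : ℝ := 1 / (3 * (1 + Δ)) with ht
  have hsymm (J : Idx n k) : ((t • s) J).IsSymm := (hL s hH.newtonStep_mem J).smul t
  have hform : blockForm Y (t • s) (t • s) = (t * Δ) ^ 2 := by
    rw [map_smul, map_smul, LinearMap.smul_apply, ← hself, smul_eq_mul, smul_eq_mul]
    ring
  have htΔ : t * Δ ≤ 1 / 3 := by
    rw [ht, div_mul_eq_mul_div, div_le_div_iff₀ (by positivity) (by norm_num)]
    linarith
  have hsmall : blockForm Y (t • s) (t • s) ≤ 1 / 9 := by
    rw [hform]
    exact (pow_le_pow_left₀ (by positivity) htΔ 2).trans_eq (by norm_num)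
  refine ⟨t, hY.add hsymm (hsmall.trans_lt (by norm_num)), (fFW_add_le hY hsymm hsmall).trans_eq ?_⟩
  rw [hform, map_smul, hgrad, ht, smul_eq_mul]
  field_simp
  ring

theorem one_div_thousand_le_newton_decrease {Δ : ℝ} (hΔ : 1 / 14 ≤ Δ) :
    1 / 1000 ≤ Δ ^ 2 * (2 + 3 * Δ) / (9 * (1 + Δ) ^ 2) := by
  rw [div_le_div_iff₀ (by norm_num) (by positivity)]
  nlinarith [mul_nonneg (sq_nonneg Δ) (sub_nonneg.2 hΔ)]

theorem isCompact_blocksPosSemidef_ip_Psi_le {P : Mat n} (hP : P.PosDef) (c : ℝ) :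
    IsCompact {Y : Blocks n k | BlocksPosSemidef Y ∧ ip P (Psi Y) ≤ c} := by
  have hPJ (J : Idx n k) : (P.submatrix (emb J) (emb J)).PosDef := hP.submatrix (emb J).injective
  have hbox : IsCompact (Set.univ.pi fun J : Idx n k =>
      {S : Mat k | S.PosSemidef ∧ ip (P.submatrix (emb J) (emb J)) S ≤ c}) :=
    isCompact_univ_pi fun J => isCompact_posSemidef_ip_le (hPJ J) c
  refine hbox.of_isClosed_subset ?_ fun Y hY J _ => ⟨hY.1 J, ?_⟩
  · simp only [BlocksPosSemidef, ip_Psi, Set.ofPred_and, Set.ofPred_forall]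
    refine (isClosed_iInter fun J =>
      isClosed_posSemidef.preimage (by fun_prop)).inter
      (isClosed_le ?_ continuous_const)
    exact continuous_finsetSum _ fun J _ => (continuous_ip _).comp (continuous_apply J)
  · refine le_trans ?_ hY.2
    rw [ip_Psi]
    exact Finset.single_le_sum (fun J _ => ip_nonneg (hPJ J) (hY.1 J)) (Finset.mem_univ J)

theorem exists_forall_fFW_le {T : Set (Blocks n k)} (hT : IsCompact T)
    (hpsd : ∀ W ∈ T, BlocksPosSemidef W) (hYT : Y ∈ T) (hY : BlocksPosDef Y) :
    ∃ Y' ∈ T, BlocksPosDef Y' ∧ ∀ W ∈ T, BlocksPosDef W → fFW Y' ≤ fFW W := by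
  have hcont : Continuous fun W : Blocks n k => ∏ J, (W J).det :=
    continuous_finsetProd _ fun J _ => (continuous_apply J).matrix_det
  obtain ⟨Y', hY'T, hmax⟩ := hT.exists_isMaxOn ⟨Y, hYT⟩ hcont.continuousOn
  have hdet {W : Blocks n k} (hW : BlocksPosDef W) : 0 < ∏ J, (W J).det :=
    Finset.prod_pos fun J _ => (hW J).det_pos
  have hY' : BlocksPosDef Y' := fun J => (hpsd Y' hY'T J).posDef_iff_det_ne_zero.2
    (Finset.prod_ne_zero_iff.1 ((hdet hY).trans_le (hmax hYT)).ne' J (Finset.mem_univ J))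
  refine ⟨Y', hY'T, hY', fun W hWT hW => ?_⟩
  rw [fFW, fFW, ← Real.log_prod fun J _ => (hY' J).det_pos.ne',
    ← Real.log_prod fun J _ => (hW J).det_pos.ne']
  exact neg_le_neg (Real.log_le_log (hdet hW) (hmax hWT))

theorem exists_isLineSearch_of_ip_Psi_le {P : Mat n} (hP : P.PosDef) (c : ℝ)
    (hc : ∀ W ∈ L, BlocksPosSemidef W → ip P (Psi W) ≤ c) (hY : BlocksPosDef Y) (hYL : Y ∈ L)
    (hstep : newtonStep fFW L Y ∈ L.direction) : ∃ Y', IsLineSearch L Y Y' := by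
  unfold IsLineSearch
  set s := newtonStep fFW L Y
  have hline : IsClosed {W : Blocks n k | W - Y ∈ Submodule.span ℝ {s}} :=
    (Submodule.closed_of_finiteDimensional _).preimage (continuous_id.sub continuous_const)
  have hmem (t : ℝ) (ht : BlocksPosDef (Y + t • s)) :
      Y + t • s ∈ {W : Blocks n k | BlocksPosSemidef W ∧ ip P (Psi W) ≤ c} ∩
        {W : Blocks n k | W - Y ∈ Submodule.span ℝ {s}} := by
    have hpsd : BlocksPosSemidef (Y + t • s) := fun J => (ht J).posSemidef
    refine ⟨⟨hpsd, hc _ ?_ hpsd⟩, ?_⟩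
    · rw [add_comm]
      exact AffineSubspace.vadd_mem_of_mem_direction (Submodule.smul_mem _ t hstep) hYL
    · rw [Set.mem_ofPred_eq, add_sub_cancel_left]
      exact Submodule.smul_mem _ t (Submodule.mem_span_singleton_self s)
  obtain ⟨Y', ⟨-, hY'line⟩, hY', hmin⟩ := exists_forall_fFW_le
    ((isCompact_blocksPosSemidef_ip_Psi_le hP c).inter_right hline) (fun W hW => hW.1.1)
    (by simpa using hmem 0 (by simpa using hY)) hY
  obtain ⟨t, ht⟩ := Submodule.mem_span_singleton.1 hY'line
  exact ⟨Y', t, by rw [ht, add_sub_cancel], hY', fun r hr => hmin _ (hmem r hr) hr⟩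

end LineSearch

section DecrementComparison

variable {n k m : ℕ} {A₀ : Mat n} {A : Fin m → Mat n} {b : Fin m → ℝ} {v : ℝ} {X S : Mat n}

theorem trace_Psi (Y : Blocks n k) : (Psi Y).trace = ∑ J, (Y J).trace := by
  have h := ip_Psi 1 Y
  simpa only [ip, submatrix_one _ (emb _).injective, one_mul] using h

theorem Y0_apply_inv (hkn : k ≤ n) (J : Idx n k) :
    (Y0 n k J)⁻¹ = ((n - 1).choose (k - 1) : ℝ) • (1 : Mat k) := by
  refine inv_eq_right_inv ?_
  rw [Y0, smul_mul_smul_comm, one_div, inv_mul_cancel₀ (choose_pos_cast hkn).ne', one_mul, one_smul]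

theorem gradFW_Y0 (hkn : k ≤ n) (U : Blocks n k) :
    gradFW (Y0 n k) U = -((n - 1).choose (k - 1) * (Psi U).trace) := by
  simp only [gradFW_apply, gradSDP_apply, Y0_apply_inv hkn, ip, smul_mul_assoc, one_mul, trace_smul,
    smul_eq_mul, Finset.sum_neg_distrib, trace_Psi, Finset.mul_sum]

theorem blockForm_Y0 (hkn : k ≤ n) (U W : Blocks n k) :
    blockForm (Y0 n k) U W = ((n - 1).choose (k - 1) : ℝ) ^ 2 * ∑ J, ip (U J) (W J) := by
  simp only [blockForm_apply, localForm_apply, Y0_apply_inv hkn, ip, one_mul,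
    smul_mul_assoc, mul_smul_comm, smul_smul, trace_smul, smul_eq_mul, Finset.mul_sum, sq]

theorem sum_ip_PsiDagger_self_le (hk : 2 ≤ k) (hkn : k ≤ n) (hS : S.IsSymm) :
    ∑ J, ip ((PsiDagger S : Blocks n k) J) ((PsiDagger S : Blocks n k) J) ≤ ip S S := by
  have hPsi : ip S S = ∑ J, ip (S.submatrix (emb J) (emb J)) ((PsiDagger S : Blocks n k) J) := by
    rw [← ip_Psi, Psi_PsiDagger hk hkn]
  have hC : (1 : ℝ) ≤ (n - 1).choose (k - 1) := by
    exact_mod_cast Nat.choose_pos (Nat.sub_le_sub_right hkn 1)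
  have hC' : (1 : ℝ) ≤ (n - 2).choose (k - 2) := by
    exact_mod_cast Nat.choose_pos (Nat.sub_le_sub_right hkn 2)
  rw [hPsi]
  refine Finset.sum_le_sum fun J _ => ?_
  simp only [ip, trace, diag, mul_apply, submatrix_apply]
  refine Finset.sum_le_sum fun p _ => Finset.sum_le_sum fun q _ => ?_
  rw [(isSymm_PsiDagger hS J).apply p q]
  set w : ℝ := if p = q then 1 / ((n - 1).choose (k - 1) : ℝ) else
    1 / ((n - 2).choose (k - 2) : ℝ) with hw
  have hw01 : 0 ≤ w ∧ w ≤ 1 := by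
    rw [hw]
    split_ifs
    · exact ⟨by positivity, div_le_one_of_le₀ hC (by positivity)⟩
    · exact ⟨by positivity, div_le_one_of_le₀ hC' (by positivity)⟩
  change w * S (emb J p) (emb J q) * (w * S (emb J p) (emb J q)) ≤
    S (emb J p) (emb J q) * (w * S (emb J p) (emb J q))
  calc _ = w * (w * S (emb J p) (emb J q) ^ 2) := by ring
    _ ≤ 1 * (w * S (emb J p) (emb J q) ^ 2) :=
      mul_le_mul_of_nonneg_right hw01.2 (mul_nonneg hw01.1 (sq_nonneg _))
    _ = _ := by ring

/-- The Cauchy–Schwarz inequality for the Newton step of `fFW` and the direction `Ψ† S`, on which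
the differential of `fFW` at `𝒴₀` takes the value `-C tr S`. -/
theorem sq_trace_le_sq_newtonDecrement_fFW_mul (hk : 2 ≤ k) (hkn : k ≤ n)
    (hX : StrictlyFeasible A b X) (hv : ip A₀ X = v) (hS : S.IsSymm)
    (hS₀ : ip A₀ (rescale X S) = 0) (hSA : ∀ i, ip (A i) (rescale X S) = 0) :
    S.trace ^ 2 ≤ newtonDecrement fFW (blockSliceAt k A₀ A b v X) (Y0 n k) ^ 2 * ip S S := by
  have hC := choose_pos_cast hkn
  have hY₀ := hX.Y0_mem_blockSliceAt hv hk hkn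
  have hH := hasPosDefHessian_fFW (Y0_posDef hkn)
    fun d hd => ((mem_blockSliceAt_direction hY₀).1 hd).1
  have hmem : PsiDagger S ∈ (blockSliceAt k A₀ A b v X).direction := by
    rw [mem_blockSliceAt_direction hY₀, Psi_PsiDagger hk hkn]
    exact ⟨isSymm_PsiDagger hS, hS₀, hSA⟩
  have hcs := hH.sq_apply_le hmem
  rw [gradFW_Y0 hkn, blockForm_Y0 hkn, Psi_PsiDagger hk hkn, neg_sq, mul_pow, mul_left_comm] at hcs
  exact (le_of_mul_le_mul_left hcs (pow_pos hC 2)).trans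
    (mul_le_mul_of_nonneg_left (sum_ip_PsiDagger_self_le hk hkn hS) (sq_nonneg _))

theorem newtonDecrement_fSDP_slice_le (hk : 2 ≤ k) (hkn : k ≤ n) (hX : StrictlyFeasible A b X)
    (hv : ip A₀ X = v) : newtonDecrement fSDP (slice A₀ A b v) X ≤
      newtonDecrement fFW (blockSliceAt k A₀ A b v X) (Y0 n k) := by
  have hdir {d : Mat n} := mem_slice_direction (d := d) (hX.mem_slice hv)
  have hH := hasPosDefHessian_fSDP hX.1 fun d hd => (hdir.1 hd).1
  refine hH.newtonDecrement_le (newtonDecrement_nonneg _ _ _) fun d hd => ?_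
  obtain ⟨hd, hd₀, hdA⟩ := hdir.1 hd
  rw [gradSDP_apply, neg_sq, ← trace_rescale hX.1.inv, localForm_eq_ip_rescale hX.1]
  refine sq_trace_le_sq_newtonDecrement_fFW_mul hk hkn hX hv (isSymm_rescale _ hd) ?_ fun i => ?_
  · rwa [rescale_rescale_inv hX.1]
  · rw [rescale_rescale_inv hX.1, hdA]

theorem newtonDecrement_fSDP_sliceAt_one_le (hk : 2 ≤ k) (hkn : k ≤ n)
    (hX : StrictlyFeasible A b X) (hv : ip A₀ X = v) :
    newtonDecrement fSDP (sliceAt A₀ A b v X) 1 ≤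
      newtonDecrement fFW (blockSliceAt k A₀ A b v X) (Y0 n k) := by
  have hdir {d : Mat n} := mem_slice_direction (d := d) (hX.one_mem_sliceAt hv)
  have hH := hasPosDefHessian_fSDP PosDef.one fun d hd => (hdir.1 hd).1
  refine hH.newtonDecrement_le (newtonDecrement_nonneg _ _ _) fun d hd => ?_
  obtain ⟨hd, hd₀, hdA⟩ := hdir.1 hd
  rw [gradSDP_apply, neg_sq, inv_one, ip, one_mul, localForm_one]
  exact sq_trace_le_sq_newtonDecrement_fFW_mul hk hkn hX hv hd (ip_rescale X A₀ d ▸ hd₀)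
    fun i => ip_rescale X (A i) d ▸ hdA i

theorem StrictlyFeasible.newtonDecrement_fSDP_le (hX : StrictlyFeasible A b X) (hk : 2 ≤ k)
    (hkn : k ≤ n) (hv : ip A₀ X = v)
    (hΔ : newtonDecrement fFW (blockSliceAt k A₀ A b v X) (Y0 n k) ≤ 1 / 14) :
    newtonDecrement fSDP (slice A₀ A b v) X ≤ 1 / 9 ∧
      newtonDecrement fSDP (sliceAt A₀ A b v X) 1 ≤ 1 / 9 :=
  have hΔ' := hΔ.trans (show (1 / 14 : ℝ) ≤ 1 / 9 by norm_num)
  ⟨(newtonDecrement_fSDP_slice_le hk hkn hX hv).trans hΔ',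
    (newtonDecrement_fSDP_sliceAt_one_le hk hkn hX hv).trans hΔ'⟩

end DecrementComparison

section Corrector

variable {n k m : ℕ} {A₀ : Mat n} {A : Fin m → Mat n} {b : Fin m → ℝ} {v η : ℝ} {X X₂ z : Mat n}
  {Y Y' : Blocks n k} {N : ℕ}

theorem newtonStep_mem_blockSliceAt_direction (hY : BlocksPosDef Y)
    (hYL : Y ∈ blockSliceAt k A₀ A b v X) :
    newtonStep fFW (blockSliceAt k A₀ A b v X) Y ∈ (blockSliceAt k A₀ A b v X).direction :=
  (hasPosDefHessian_fFW hY fun _ hd =>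
    ((mem_blockSliceAt_direction hYL).1 hd).1).newtonStep_mem

theorem IsLineSearch.mem_blockSliceAt (h : IsLineSearch (blockSliceAt k A₀ A b v X) Y Y')
    (hY : BlocksPosDef Y) (hYL : Y ∈ blockSliceAt k A₀ A b v X) :
    Y' ∈ blockSliceAt k A₀ A b v X := by
  obtain ⟨t, rfl, -⟩ := h
  rw [add_comm]
  exact AffineSubspace.vadd_mem_of_mem_direction
    (Submodule.smul_mem _ t (newtonStep_mem_blockSliceAt_direction hY hYL)) hYL

theorem IsLineSearch.fFW_add_le {L : AffineSubspace ℝ (Blocks n k)} (h : IsLineSearch L Y Y')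
    (hY : BlocksPosDef Y) (hL : ∀ d ∈ L.direction, ∀ J, (d J).IsSymm)
    (hΔ : 1 / 14 ≤ newtonDecrement fFW L Y) : fFW Y' + 1 / 1000 ≤ fFW Y := by
  obtain ⟨t, -, -, hmin⟩ := h
  obtain ⟨s, hs, hdecrease⟩ := exists_fFW_add_smul_newtonStep_le hY hL
  linarith [hmin s hs, one_div_thousand_le_newton_decrease hΔ]

/-- The state `(X, 𝒴)` of a corrector phase is feasible: `X` is strictly feasible with objective
value `v`, and `𝒴` is an interior point of the product cone lying in `L^Ψ_X(v)`. -/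
structure IsFeasibleState (A₀ : Mat n) (A : Fin m → Mat n) (b : Fin m → ℝ) (v : ℝ) (X : Mat n)
    (Y : Blocks n k) : Prop where
  strictlyFeasible : StrictlyFeasible A b X
  ip_eq : ip A₀ X = v
  blocksPosDef : BlocksPosDef Y
  mem : Y ∈ blockSliceAt k A₀ A b v X

/-- The feasible part of the slice is bounded because `⟨z⁻¹, ·⟩` is constant on `L(v)` when `z` is
a central point. -/
theorem IsFeasibleState.exists_isLineSearch (h : IsFeasibleState A₀ A b v X Y)
    (hz : IsCentralPoint A₀ A b η z) : ∃ Y', IsLineSearch (blockSliceAt k A₀ A b v X) Y Y' := by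
  refine exists_isLineSearch_of_ip_Psi_le ((posDef_rescale_iff h.strictlyFeasible.1).2 hz.2.1.1.inv)
    (n + η * (v - ip A₀ z)) (fun W hW _ => ?_) h.blocksPosDef h.mem
    (newtonStep_mem_blockSliceAt_direction h.blocksPosDef h.mem)
  obtain ⟨hWsymm, hW₀, hWA⟩ := mem_blockSliceAt.1 hW
  rw [← ip_rescale, hz.ip_inv_eq_add (isSymm_rescale X (isSymm_Psi hWsymm)) hWA, hW₀]

/-- The potential of the state `(X, 𝒴)`. It measures progress across rescalings, which do not
increase it, while line searches decrease `fFW` and leave `X` alone. -/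
def potential (X : Mat n) (Y : Blocks n k) : ℝ :=
  ((n - 1).choose (k - 1) : ℝ) * fSDP X + (fFW Y - fFW (Y0 n k))

theorem potential_Y0 (X : Mat n) :
    potential X (Y0 n k) = ((n - 1).choose (k - 1) : ℝ) * fSDP X := by
  rw [potential, sub_self, add_zero]

theorem potential_rescale_le (hk : 0 < k) (hkn : k ∣ n) (hn : 0 < n) (hX : X.PosDef)
    (hY : BlocksPosDef Y) : potential (rescale X (Psi Y)) (Y0 n k) ≤ potential X Y := by
  have hPsi := Psi_posDef hk (Nat.le_of_dvd hn hkn) hY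
  rw [potential_Y0, fSDP_rescale hX hPsi, mul_add, potential]
  exact add_le_add_right (choose_mul_fSDP_Psi_le hk hkn hn hY) _

theorem StrictlyFeasible.isFeasibleState_Y0 (hX : StrictlyFeasible A b X) (hv : ip A₀ X = v)
    (hk : 2 ≤ k) (hkn : k ≤ n) : IsFeasibleState A₀ A b v X (Y0 n k) :=
  ⟨hX, hv, Y0_posDef hkn, hX.Y0_mem_blockSliceAt hv hk hkn⟩

namespace CorrectorRun

theorem isFeasibleState (h : CorrectorRun k A₀ A b v X₂ X Y N) (hk : 2 ≤ k) (hkn : k ≤ n)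
    (hX₂ : StrictlyFeasible A b X₂) (hv : ip A₀ X₂ = v) : IsFeasibleState A₀ A b v X Y := by
  induction h with
  | start => exact hX₂.isFeasibleState_Y0 hv hk hkn
  | lineSearch _ _ hsearch ih =>
    have hY'L := hsearch.mem_blockSliceAt ih.blocksPosDef ih.mem
    obtain ⟨t, -, hY', -⟩ := hsearch
    exact ⟨ih.strictlyFeasible, ih.ip_eq, hY', hY'L⟩
  | rescaling _ ih =>
    obtain ⟨-, hv', hA⟩ := mem_blockSliceAt.1 ih.mem
    refine StrictlyFeasible.isFeasibleState_Y0 ⟨?_, hA⟩ hv' hk hkn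
    exact (posDef_rescale_iff ih.strictlyFeasible.1).2
      (Psi_posDef (two_pos.trans_le hk) hkn ih.blocksPosDef)

theorem potential_add_le (h : CorrectorRun k A₀ A b v X₂ X Y N) (hk : 2 ≤ k) (hkn : k ∣ n)
    (hn : 0 < n) (hX₂ : StrictlyFeasible A b X₂) (hv : ip A₀ X₂ = v) :
    potential X Y + N / 1000 ≤ ((n - 1).choose (k - 1) : ℝ) * fSDP X₂ := by
  have hkn' := Nat.le_of_dvd hn hkn
  induction h with
  | start => rw [potential_Y0, Nat.cast_zero, zero_div, add_zero]
  | lineSearch hrun hΔ hsearch ih =>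
    have hstate := hrun.isFeasibleState hk hkn' hX₂ hv
    have hdecrease := hsearch.fFW_add_le hstate.blocksPosDef
      (fun d hd => ((mem_blockSliceAt_direction hstate.mem).1 hd).1) hΔ.le
    rw [potential] at ih ⊢
    push_cast
    linarith
  | rescaling hrun ih =>
    have hstate := hrun.isFeasibleState hk hkn' hX₂ hv
    exact (add_le_add_left (potential_rescale_le (two_pos.trans_le hk) hkn hn
      hstate.strictlyFeasible.1 hstate.blocksPosDef) _).trans ih

theorem count_le (h : CorrectorRun k A₀ A b v X₂ X Y N) (hk : 2 ≤ k) (hkn : k ∣ n) (hn : 0 < n)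
    (hX₂ : StrictlyFeasible A b X₂) (hv : ip A₀ X₂ = v) (hz : IsCentralPoint A₀ A b η z)
    (hvz : v ≤ ip A₀ z) :
    (N : ℝ) ≤ 1000 * ((n - 1).choose (k - 1) : ℝ) * (fSDP X₂ - fSDP z) := by
  have hstate := h.rescaling.isFeasibleState hk (Nat.le_of_dvd hn hkn) hX₂ hv
  have hpotential := h.rescaling.potential_add_le hk hkn hn hX₂ hv
  have hmin := hz.fSDP_le hstate.strictlyFeasible (hstate.ip_eq.trans_le hvz)
  rw [potential_Y0] at hpotential
  linarith [mul_le_mul_of_nonneg_left hmin (Nat.cast_nonneg (α := ℝ) ((n - 1).choose (k - 1)))]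

theorem count_le_ceil (h : CorrectorRun k A₀ A b v X₂ X Y N) (hk : 2 ≤ k) (hkn : k ∣ n)
    (hn : 0 < n) (hX₂ : StrictlyFeasible A b X₂) (hv : ip A₀ X₂ = v)
    (hz : IsCentralPoint A₀ A b η z) (hvz : v ≤ ip A₀ z) {ℓ : ℝ} (hℓ : 0 ≤ ℓ)
    (hgap : fSDP X₂ - fSDP z ≤ ℓ + 1 / 81) :
    N ≤ ⌈2688 * ((n - 1).choose (k - 1) : ℝ) * (ℓ + 1 / 154)⌉₊ := by
  have hbound : 1000 * (fSDP X₂ - fSDP z) ≤ 2688 * (ℓ + 1 / 154) := by linarith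
  have hcount := h.count_le hk hkn hn hX₂ hv hz hvz
  rw [mul_right_comm] at hcount
  rw [← Nat.cast_le (α := ℝ), mul_right_comm]
  exact (hcount.trans (mul_le_mul_of_nonneg_right hbound (Nat.cast_nonneg _))).trans (Nat.le_ceil _)

theorem exists_newtonDecrement_le {K : ℕ}
    (hcount : ∀ X (Y : Blocks n k) N, CorrectorRun k A₀ A b v X₂ X Y N → N ≤ K)
    (hsearch : ∀ X (Y : Blocks n k) N, CorrectorRun k A₀ A b v X₂ X Y N →
      1 / 14 < newtonDecrement fFW (blockSliceAt k A₀ A b v X) Y →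
        ∃ Y', IsLineSearch (blockSliceAt k A₀ A b v X) Y Y') :
    ∃ X N, CorrectorRun k A₀ A b v X₂ X (Y0 n k) N ∧
      newtonDecrement fFW (blockSliceAt k A₀ A b v X) (Y0 n k) ≤ 1 / 14 := by
  by_contra! hfar
  have hrun (N : ℕ) : ∃ X, CorrectorRun k A₀ A b v X₂ X (Y0 n k) N := by
    induction N with
    | zero => exact ⟨X₂, start⟩
    | succ N ih =>
      obtain ⟨X, h⟩ := ih
      obtain ⟨Y', hY'⟩ := hsearch X _ N h (hfar X N h)
      exact ⟨_, (h.lineSearch (hfar X N h) hY').rescaling⟩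
  obtain ⟨X, h⟩ := hrun (K + 1)
  exact K.not_succ_le_self (hcount X _ _ h)

end CorrectorRun

theorem StrictlyFeasible.fSDP_sub_le_of_newtonDecrement_le (hX : StrictlyFeasible A b X)
    (hz : StrictlyFeasible A b z) (hzX : ip A₀ z = ip A₀ X)
    (hΔ : newtonDecrement fSDP (slice A₀ A b (ip A₀ X)) X ≤ 1 / 9) :
    fSDP X - fSDP z ≤ 1 / 81 := by
  have hXL := hX.mem_slice (A₀ := A₀) rfl
  have hgap := fSDP_sub_le_sq_newtonDecrement hX.1
    (fun d hd => ((mem_slice_direction hXL).1 hd).1) hz.1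
    (AffineSubspace.vsub_mem_direction (hz.mem_slice hzX) hXL) (hΔ.trans (by norm_num))
  exact hgap.trans ((pow_le_pow_left₀ (newtonDecrement_nonneg _ _ _) hΔ 2).trans_eq (by norm_num))

end Corrector

end FactorWidth

end

theorem mainTheorem5 {n k m : ℕ} (hn : 0 < n) (hk : 2 ≤ k) (hkn : k ∣ n)
    (A₀ : FactorWidth.Mat n) (A : Fin m → FactorWidth.Mat n)
    (hA₀ : A₀.IsSymm) (hA : ∀ i, (A i).IsSymm) (b : Fin m → ℝ)
    (σ : ℝ) (hσ0 : 0 < σ) (hσ1 : σ < 1)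
    (X₁ X₂ : FactorWidth.Mat n) (hX₁ : FactorWidth.StrictlyFeasible A b X₁)
    (hcentral : ∃ η z, FactorWidth.IsCentralPoint A₀ A b η z ∧
      FactorWidth.ip A₀ z = FactorWidth.ip A₀ X₁)
    (hclose : FactorWidth.newtonDecrement FactorWidth.fSDP
      (FactorWidth.slice A₀ A b (FactorWidth.ip A₀ X₁)) X₁ ≤ 1 / 9)
    (hpred : FactorWidth.IsPredictorStep k A₀ A σ X₁ X₂)
    (v₂ : ℝ) (hv₂ : v₂ = FactorWidth.ip A₀ X₂)
    (K : ℕ) (hK : K = ⌈2688 * ((n - 1).choose (k - 1) : ℝ) *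
      ((n : ℝ) * Real.log (1 / (1 - σ)) + 1 / 154)⌉₊) :
    -- the target on the central path exists
    (∃ η z, FactorWidth.IsCentralPoint A₀ A b η z ∧ FactorWidth.ip A₀ z = v₂) ∧
    -- whatever the rescaling policy, every corrector phase makes at most `K` line searches, never
    -- gets stuck, and is close to the central path once its stopping test is met
    (∀ X Y N, FactorWidth.CorrectorRun k A₀ A b v₂ X₂ X Y N →
      N ≤ K ∧
      FactorWidth.StrictlyFeasible A b X ∧ FactorWidth.ip A₀ X = v₂ ∧
      (1 / 14 < FactorWidth.newtonDecrement FactorWidth.fFW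
          (FactorWidth.blockSliceAt k A₀ A b v₂ X) Y →
        ∃ Y', FactorWidth.IsLineSearch (FactorWidth.blockSliceAt k A₀ A b v₂ X) Y Y') ∧
      (FactorWidth.newtonDecrement FactorWidth.fFW
          (FactorWidth.blockSliceAt k A₀ A b v₂ X) (FactorWidth.Y0 n k) ≤ 1 / 14 →
        FactorWidth.newtonDecrement FactorWidth.fSDP
            (FactorWidth.slice A₀ A b v₂) X ≤ 1 / 9 ∧
        FactorWidth.newtonDecrement FactorWidth.fSDP
            (FactorWidth.sliceAt A₀ A b v₂ X) 1 ≤ 1 / 9)) ∧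
    -- hence a point at which the next predictor step can be taken is found within `K` line searches
    (∃ X N, FactorWidth.CorrectorRun k A₀ A b v₂ X₂ X (FactorWidth.Y0 n k) N ∧ N ≤ K ∧
      FactorWidth.newtonDecrement FactorWidth.fFW
        (FactorWidth.blockSliceAt k A₀ A b v₂ X) (FactorWidth.Y0 n k) ≤ 1 / 14 ∧
      FactorWidth.newtonDecrement FactorWidth.fSDP (FactorWidth.slice A₀ A b v₂) X ≤ 1 / 9) := by
  subst hv₂ hK
  have hkn' := Nat.le_of_dvd hn hkn
  obtain ⟨η, z, hz, hzX₁⟩ := hcentral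
  obtain ⟨hX₂, hdecrease, hbarrier⟩ :=
    hpred.strictlyFeasible_and_le hk hkn' hA₀ hA hσ0.le hσ1 ⟨η, z, hz⟩ hX₁
  have hle := hdecrease.trans_eq hzX₁.symm
  have hgap := hX₁.fSDP_sub_le_of_newtonDecrement_le hz.2.1 hzX₁ hclose
  have hlog : 0 ≤ n * Real.log (1 / (1 - σ)) := mul_nonneg n.cast_nonneg
    (Real.log_nonneg (one_le_one_div (sub_pos.2 hσ1) (sub_le_self 1 hσ0.le)))
  have hcount X Y N (h : FactorWidth.CorrectorRun k A₀ A b _ X₂ X Y N) :=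
    h.count_le_ceil hk hkn hn hX₂ rfl hz hle hlog (by linarith)
  have hstate X Y N (h : FactorWidth.CorrectorRun k A₀ A b _ X₂ X Y N) :=
    h.isFeasibleState hk hkn' hX₂ rfl
  have hsearch X Y N (h : FactorWidth.CorrectorRun k A₀ A b _ X₂ X Y N) :=
    (hstate X Y N h).exists_isLineSearch hz
  have hrun X Y N (h : FactorWidth.CorrectorRun k A₀ A b _ X₂ X Y N) :=
    (hstate X Y N h).strictlyFeasible.newtonDecrement_fSDP_le hk hkn' (hstate X Y N h).ip_eq
  refine ⟨hz.exists_isCentralPoint_of_ip_le hX₂ hle, fun X Y N h => ⟨hcount X Y N h,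
    (hstate X Y N h).strictlyFeasible, (hstate X Y N h).ip_eq, fun _ => hsearch X Y N h,
    hrun X Y N h⟩, ?_⟩
  obtain ⟨X, N, h, hΔ⟩ := FactorWidth.CorrectorRun.exists_newtonDecrement_le hcount
    fun X Y N h _ => hsearch X Y N h
  exact ⟨X, N, h, hcount X _ N h, hΔ, (hrun X _ N h hΔ).1⟩
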